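/- Let $k,m$ be positive integers and $\mathbb K=\mathbb C$ (or $\mathbb R$). Consider $\mathbb K$-valued functions of the variables $s$, $\boldsymbol t=(t_1,t_2,\dots)$, $\bar{\boldsymbol t}=(\bar t_1,\bar t_2,\dots)$, $\boldsymbol x=(x_1,x_2,\dots)$ with the identifications $x_0=s$ and $t_{nk}=\bar t_{nm}$ ($n\ge1$, one variable each), on a domain $\Omega$ that is invariant under $s\mapsto s\pm1$ and open in any finite number of variables; smooth means infinitely differentiable (holomorphic if $\mathbb K=\mathbb C$) in any finite number of variables. Let $(\Lambda f)(s)=f(s+1)$. For a formal difference operator $A=\sum_{i\in\mathbb Z}a_i(s)\Lambda^i$ put $A_+=\sum_{i\ge0}a_i\Lambda^i$, $A_-=\sum_{i<0}a_i\Lambda^i$ and $A^*=\sum_i\Lambda^{-i}\circ a_i(s)$. Let $W=1+\sum_{i\ge1}w_i(s)\Lambda^{-i}$ and $\bar W=\sum_{i\ge0}\bar w_i(s)\Lambda^i$, with smooth coefficients and $\bar w_0$ nowhere zero, be wave operators of a solution $L=\Lambda^k+u_{k-1}\Lambda^{k-1}+\dots+u_{-m}\Lambda^{-m}$, $u_{-m}\ne0$,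 of the extended bigraded Toda hierarchy (EBTH). That is, $L=W\Lambda^kW^{-1}=\bar W\Lambda^{-m}\bar W^{-1}$ and, with $L^{n/k}=W\Lambda^nW^{-1}$, $L^{n/m}=\bar W\Lambda^{-n}\bar W^{-1}$ and $\log L=-\tfrac12\frac{\partial W}{\partial s}W^{-1}+\tfrac12\frac{\partial\bar W}{\partial s}\bar W^{-1}$, $$\partial_yW=-B_-W,\qquad \partial_y\bar W=B_+\bar W$$ for $(y,B)=(t_n,L^{n/k})$ and $(y,B)=(\bar t_n,L^{n/m})$ with $n\ge1$, and for $(y,B)=(x_n,2L^n\log L)$ with $n\ge0$. Put $\xi(\boldsymbol t,z)=\sum_{i\ge1}t_iz^i$, $\xi_k(\boldsymbol t,z)=\sum_{n\ge1}t_{nk}z^{nk}$, $\xi_m(\bar{\boldsymbol t},z)=\sum_{n\ge1}\bar t_{nm}z^{nm}$ and $$\chi=z^{s+\xi(\boldsymbol x,z^k)}e^{\xi(\boldsymbol t,z)-\frac12\xi_k(\boldsymbol t,z)},\qquad \bar\chi=z^{s+\xi(\boldsymbol x,z^{-m})}e^{-\xi(\bar{\boldsymbol t},z^{-1})+\frac12\xi_m(\bar{\boldsymbol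 t},z^{-1})}.$$ Let $\psi=W\chi$ and $\bar\psi=\bar W\bar\chi$ be the wave functions, and let $$\psi^*=\Lambda^{-1}(W^*)^{-1}\Lambda\,\chi^{-1},\qquad \bar\psi^*=\Lambda^{-1}(\bar W^*)^{-1}\Lambda\,\bar\chi^{-1}$$ be the dual wave functions, i.e. $z^{-1}(W^*)^{-1}\chi^{-1}$ and $z^{-1}(\bar W^*)^{-1}\bar\chi^{-1}$ with $s$ replaced by $s-1$. Let $[z]=(z,\frac{z^2}2,\frac{z^3}3,\dots)$. A function of $\boldsymbol t\pm[z^{-1}]$ (respectively of $\bar{\boldsymbol t}\pm[z]$) is understood as its formal Taylor series in $z^{-1}$ (respectively $z$). In $\boldsymbol t\pm[z^{-1}]$ all variables $t_1,t_2,\dots$ are shifted, and the $\bar t_j$ with $m\nmid j$ are not; in $\bar{\boldsymbol t}\pm[z]$ all variables $\bar t_1,\bar t_2,\dots$ are shifted, and the $t_i$ with $k\nmid i$ are not. Let $\tau$ be a tau-function of the solution, i.e. a smooth nowhere vanishing function with $$\psi=\frac{\tau(s,\boldsymbol t-[z^{-1}],\bar{\boldsymbol t},\boldsymbol x)}{\tau(s,\boldsymbol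 t,\bar{\boldsymbol t},\boldsymbol x)}\,\chi,\qquad \bar\psi=\frac{\tau(s+1,\boldsymbol t,\bar{\boldsymbol t}+[z],\boldsymbol x)}{\tau(s,\boldsymbol t,\bar{\boldsymbol t},\boldsymbol x)}\,\bar\chi .$$ Then $$\psi^*=\frac{\tau(s,\boldsymbol t+[z^{-1}],\bar{\boldsymbol t},\boldsymbol x)}{\tau(s,\boldsymbol t,\bar{\boldsymbol t},\boldsymbol x)}\,\chi^{-1},\qquad \bar\psi^*=\frac{\tau(s-1,\boldsymbol t,\bar{\boldsymbol t}-[z],\boldsymbol x)}{\tau(s,\boldsymbol t,\bar{\boldsymbol t},\boldsymbol x)}\,\bar\chi^{-1}.$$ Equivalently, $$(W^*)^{-1}\chi^{-1}=\frac{\tau(s+1,\boldsymbol t+[z^{-1}],\bar{\boldsymbol t},\boldsymbol x)}{\tau(s+1,\boldsymbol t,\bar{\boldsymbol t},\boldsymbol x)}\,\chi^{-1},\qquad (\bar W^*)^{-1}\bar\chi^{-1}=\frac{\tau(s,\boldsymbol t,\bar{\boldsymbol t}-[z],\boldsymbol x)}{\tau(s+1,\boldsymbol t,\bar{\boldsymbol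 t},\boldsymbol x)}\,\bar\chi^{-1}.$$ -/

import Mathlib

open scoped ContDiff

noncomputable section

namespace EBTH

/-! ### Variables, domains, functions -/

/-- The independent variables of the hierarchy after the identifications `x₀ = s` and
`t_{nk} = t̄_{nm}` (`n ≥ 1`): all `t_i` with `i ≥ 1`, the `t̄_j` with `j ≥ 1` and `m ∤ j`, and all
`x_n` with `n ≥ 0`. -/
inductive TodaVar (k m : ℕ+) : Type
  | t (i : ℕ+) : TodaVar k m
  | tbarFree (j : {j : ℕ+ // ¬ m ∣ j}) : TodaVar k m
  | x (n : ℕ) : TodaVar k m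

variable {𝕜 : Type*} [RCLike 𝕜] {k m : ℕ+}

/-- The variable `s = x₀`. -/
def TodaVar.s : TodaVar k m := TodaVar.x 0

open Classical in
/-- The variable `t̄_j`, for every `j ≥ 1`; for `j = nm` it is the variable `t_{nk}`. -/
def TodaVar.tbar (j : ℕ+) : TodaVar k m :=
  if h : m ∣ j then TodaVar.t (k * PNat.divExact j m) else TodaVar.tbarFree ⟨j, h⟩

/-- A point `(s, t, t̄, x)`: a value for each variable. -/
abbrev Point (𝕜 : Type*) (k m : ℕ+) : Type _ := TodaVar k m → 𝕜

open Classical in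
/-- The unit vector in the direction of the variable `v`. -/
def unitVec (𝕜 : Type*) [RCLike 𝕜] (v : TodaVar k m) : Point 𝕜 k m := Pi.single v 1

/-- The domain of the functions under consideration: a set of points that is invariant under
`s ↦ s + j`, `j ∈ ℤ`, and whose slices in any finite number of variables (the other variables being
fixed) are open. -/
structure Domain (𝕜 : Type*) [RCLike 𝕜] (k m : ℕ+) where
  carrier : Set (Point 𝕜 k m)
  shift_mem : ∀ p ∈ carrier, ∀ j : ℤ, p + (j : 𝕜) • unitVec 𝕜 TodaVar.s ∈ carrier
  isOpen_slice : ∀ (p : Point 𝕜 k m) (F : Finset (TodaVar k m)),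
    IsOpen {y : F → 𝕜 | p + ∑ v : F, y v • unitVec 𝕜 v.1 ∈ carrier}

/-- Functions of `(s, t, t̄, x)` on the domain `Ω`. -/
abbrev Fn (Ω : Domain 𝕜 k m) : Type _ := Ω.carrier → 𝕜

variable {Ω : Domain 𝕜 k m}

/-- The point with `s` replaced by `s + j`. -/
def Domain.shift (Ω : Domain 𝕜 k m) (j : ℤ) (p : Ω.carrier) : Ω.carrier :=
  ⟨p.1 + (j : 𝕜) • unitVec 𝕜 TodaVar.s, Ω.shift_mem p.1 p.2 j⟩

/-- `(Λ^j f)(s) = f(s + j)`. -/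
def Fn.shift (j : ℤ) (f : Fn Ω) : Fn Ω := fun p => f (Ω.shift j p)

/-- The coordinate function of the variable `v`. -/
def coord (v : TodaVar k m) : Fn Ω := fun p => p.1 v

/-- Extension by zero outside of the domain. -/
def Fn.ext (f : Fn Ω) : Point 𝕜 k m → 𝕜 := Function.extend Subtype.val f 0

/-- The partial derivative `∂f/∂v`. -/
def Fn.pd (v : TodaVar k m) (f : Fn Ω) : Fn Ω :=
  fun p => deriv (fun u : 𝕜 => f.ext (p.1 + u • unitVec 𝕜 v)) 0

/-- `f` is infinitely differentiable (holomorphic, if `𝕜 = ℂ`) jointly in any finite number of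
variables, the other variables being fixed. -/
def Fn.Smooth (f : Fn Ω) : Prop :=
  ∀ (p : Point 𝕜 k m) (F : Finset (TodaVar k m)),
    ContDiffOn 𝕜 ∞ (fun y : F → 𝕜 => f.ext (p + ∑ v : F, y v • unitVec 𝕜 v.1))
      {y : F → 𝕜 | p + ∑ v : F, y v • unitVec 𝕜 v.1 ∈ Ω.carrier}

/-! ### Difference operators -/

/-- A formal difference operator `A = ∑_{i ∈ ℤ} a_i(s) Λ^i`, given by its coefficients. -/
def DiffOp (Ω : Domain 𝕜 k m) : Type _ := ℤ → Fn Ω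

namespace DiffOp

instance : AddCommGroup (DiffOp Ω) := inferInstanceAs (AddCommGroup (ℤ → Fn Ω))

instance : Module 𝕜 (DiffOp Ω) := inferInstanceAs (Module 𝕜 (ℤ → Fn Ω))

/-- `(a(s) Λ^i)(b(s) Λ^j) = a(s) b(s+i) Λ^{i+j}`. The sum below is finite at each point whenever
the product is well defined: both factors have powers of `Λ` bounded from above, or both bounded
from below, or one of the factors has finitely many terms. -/
instance : Mul (DiffOp Ω) :=
  ⟨fun A B n p => ∑ᶠ i : ℤ, A i p * Fn.shift i (B (n - i)) p⟩

/-- The operator `Λ^j`. -/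
def lam (j : ℤ) : DiffOp Ω := fun i => if i = j then 1 else 0

instance : One (DiffOp Ω) := ⟨lam 0⟩

/-- Powers: `A^0 = 1`, `A^(n+1) = A^n * A`. -/
instance : Pow (DiffOp Ω) ℕ := ⟨fun A n => npowRec n A⟩

/-- The projection `A_+ = ∑_{i ≥ 0} a_i Λ^i`. -/
def pos (A : DiffOp Ω) : DiffOp Ω := fun i => if 0 ≤ i then A i else 0

/-- The projection `A_- = ∑_{i < 0} a_i Λ^i`. -/
def neg (A : DiffOp Ω) : DiffOp Ω := fun i => if i < 0 then A i else 0

/-- The space `𝒜_{++}`: powers of `Λ` bounded from below. -/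
def bddBelow (Ω : Domain 𝕜 k m) : Set (DiffOp Ω) := {A | ∃ N : ℤ, ∀ i < N, A i = 0}

/-- The space `𝒜_{--}`: powers of `Λ` bounded from above. -/
def bddAbove (Ω : Domain 𝕜 k m) : Set (DiffOp Ω) := {A | ∃ N : ℤ, ∀ i > N, A i = 0}

/-- The (unique) inverse of `A` in the algebra `𝒮`, where `𝒮` is `𝒜_{++}` or `𝒜_{--}`. -/
def inv (𝒮 : Set (DiffOp Ω)) (A : DiffOp Ω) : DiffOp Ω :=
  Classical.epsilon fun B => B ∈ 𝒮 ∧ A * B = 1 ∧ B * A = 1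

/-- The formal adjoint `A^* = ∑ Λ^{-i} ∘ a_i(s) = ∑ a_i(s-i) Λ^{-i}`. -/
def adjoint (A : DiffOp Ω) : DiffOp Ω := fun n => Fn.shift n (A (-n))

/-- The coefficientwise derivative `∂A/∂v`. -/
def pd (v : TodaVar k m) (A : DiffOp Ω) : DiffOp Ω := fun i => Fn.pd v (A i)

end DiffOp

open DiffOp

/-! ### The extended bigraded Toda hierarchy -/

/-- `L^{n/k} = W Λ^n W⁻¹`, computed in `𝒜_{--}`. -/
def fracPow (W : DiffOp Ω) (n : ℕ) : DiffOp Ω := W * lam n * inv (bddAbove Ω) W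

/-- `L^{n/m} = W̄ Λ^{-n} W̄⁻¹`, computed in `𝒜_{++}`. -/
def fracPowBar (Wbar : DiffOp Ω) (n : ℕ) : DiffOp Ω :=
  Wbar * lam (-n) * inv (bddBelow Ω) Wbar

/-- `log L = -½ (∂W/∂s) W⁻¹ + ½ (∂W̄/∂s) W̄⁻¹`. -/
def logL (W Wbar : DiffOp Ω) : DiffOp Ω :=
  -((2⁻¹ : 𝕜) • (pd TodaVar.s W * inv (bddAbove Ω) W))
    + (2⁻¹ : 𝕜) • (pd TodaVar.s Wbar * inv (bddBelow Ω) Wbar)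

/-- The operator `2 Lⁿ log L`. -/
def twoPowLog (L W Wbar : DiffOp Ω) (n : ℕ) : DiffOp Ω := (2 : 𝕜) • (L ^ n * logL W Wbar)

/-- `L = Λ^k + u_{k-1} Λ^{k-1} + ⋯ + u_{-m} Λ^{-m}` with `u_{-m} ≠ 0`. -/
structure IsLax (L : DiffOp Ω) : Prop where
  top : L (k : ℤ) = 1
  above : ∀ i : ℤ, (k : ℤ) < i → L i = 0
  below : ∀ i : ℤ, i < -(m : ℤ) → L i = 0
  bot : ∀ p, L (-(m : ℤ)) p ≠ 0

/-- `W` and `W̄` are wave operators of the Lax operator `L`, which solves the extended bigraded Toda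
hierarchy: `W = 1 + ∑_{i ≥ 1} w_i Λ^{-i}`, `W̄ = ∑_{i ≥ 0} w̄_i Λ^i` with `w̄_0 ≠ 0`,
`L = W Λ^k W⁻¹ = W̄ Λ^{-m} W̄⁻¹`, and the flows of the hierarchy hold. -/
structure IsSolution (L W Wbar : DiffOp Ω) : Prop where
  lax : IsLax L
  W_smooth : ∀ i, (W i).Smooth
  W_zero : W 0 = 1
  W_pos : ∀ i : ℤ, 0 < i → W i = 0
  Wbar_smooth : ∀ i, (Wbar i).Smooth
  Wbar_zero : ∀ p, Wbar 0 p ≠ 0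
  Wbar_neg : ∀ i : ℤ, i < 0 → Wbar i = 0
  dress : L = W * lam k * inv (bddAbove Ω) W
  dressBar : L = Wbar * lam (-(m : ℤ)) * inv (bddBelow Ω) Wbar
  flow_t : ∀ n : ℕ+, pd (TodaVar.t n) W = -(neg (fracPow W n) * W)
  flow_t_bar : ∀ n : ℕ+, pd (TodaVar.t n) Wbar = pos (fracPow W n) * Wbar
  flow_tbar : ∀ n : ℕ+, pd (TodaVar.tbar n) W = -(neg (fracPowBar Wbar n) * W)
  flow_tbar_bar : ∀ n : ℕ+, pd (TodaVar.tbar n) Wbar = pos (fracPowBar Wbar n) * Wbar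
  flow_x : ∀ n : ℕ, pd (TodaVar.x n) W = -(neg (twoPowLog L W Wbar n) * W)
  flow_x_bar : ∀ n : ℕ, pd (TodaVar.x n) Wbar = pos (twoPowLog L W Wbar n) * Wbar

/-! ### Wave functions

The functions `χ`, `χ̄` and the wave functions are formal expressions in the spectral parameter `z`,
of the form `f(z) e^{a(z) log z + b(z)}`, where `f`, `a`, `b` are formal sums of powers of `z` with
coefficients that are functions of `(s, t, t̄, x)`. -/

/-- A formal sum `∑_{i ∈ ℤ} f_i z^i`, given by its coefficients. -/
abbrev ZSeries (Ω : Domain 𝕜 k m) : Type _ := ℤ → Fn Ω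

/-- The exponent `θ = a(z) log z + b(z)`, given as the pair `(a, b)`. -/
abbrev Phase (Ω : Domain 𝕜 k m) : Type _ := ZSeries Ω × ZSeries Ω

/-- The formal expression `f(z) e^θ`. -/
@[ext]
structure Osc (Ω : Domain 𝕜 k m) where
  amp : ZSeries Ω
  phase : Phase Ω

/-- The exponent with `s` replaced by `s + j`. -/
def Phase.shift (j : ℤ) (θ : Phase Ω) : Phase Ω :=
  (fun i => Fn.shift j (θ.1 i), fun i => Fn.shift j (θ.2 i))

/-- The exponent `n log z` of `z^n`. -/
def Phase.logz (n : ℤ) : Phase Ω := (fun i => if i = 0 then fun _ => (n : 𝕜) else 0, 0)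

open Classical in
/-- `A e^θ = (∑_i a_i z^{n(i)}) e^θ` for a difference operator `A = ∑ a_i Λ^i` and an exponent such
that `Λ^i e^θ = z^{n(i)} e^θ` for all `i`. For `e^θ = χ, χ̄` one has `n(i) = i`, and for
`e^θ = χ⁻¹, χ̄⁻¹` one has `n(i) = -i`. -/
def applyExp (A : DiffOp Ω) (θ : Phase Ω) : Osc Ω where
  amp n p := ∑ᶠ i : ℤ, if Phase.shift i θ = θ + Phase.logz n then A i p else 0
  phase := θ

open Classical in
/-- The exponent `(s + ξ(x, z^k)) log z + ξ(t, z) - ½ ξ_k(t, z)` of `χ`, where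
`ξ(x, z^k) = ∑_{n ≥ 1} x_n z^{nk}`, `ξ(t, z) = ∑_{i ≥ 1} t_i z^i`,
`ξ_k(t, z) = ∑_{n ≥ 1} t_{nk} z^{nk}`. -/
def chi (Ω : Domain 𝕜 k m) : Phase Ω :=
  (fun i => if 0 ≤ i ∧ (k : ℤ) ∣ i then coord (TodaVar.x (i / k).toNat) else 0,
   fun i => if hi : 0 < i then
      coord (TodaVar.t ⟨i.toNat, by omega⟩)
        - if (k : ℤ) ∣ i then (2⁻¹ : 𝕜) • coord (TodaVar.t ⟨i.toNat, by omega⟩) else 0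
    else 0)

open Classical in
/-- The exponent `(s + ξ(x, z^{-m})) log z - ξ(t̄, z⁻¹) + ½ ξ_m(t̄, z⁻¹)` of `χ̄`. -/
def chiBar (Ω : Domain 𝕜 k m) : Phase Ω :=
  (fun i => if i ≤ 0 ∧ (m : ℤ) ∣ i then coord (TodaVar.x (-i / m).toNat) else 0,
   fun i => if hi : i < 0 then
      -coord (TodaVar.tbar ⟨(-i).toNat, by omega⟩)
        + if (m : ℤ) ∣ i then (2⁻¹ : 𝕜) • coord (TodaVar.tbar ⟨(-i).toNat, by omega⟩) else 0
    else 0)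

/-- The wave function `ψ = W χ`. -/
def wave (W : DiffOp Ω) : Osc Ω := applyExp W (chi Ω)

/-- The wave function `ψ̄ = W̄ χ̄`. -/
def waveBar (Wbar : DiffOp Ω) : Osc Ω := applyExp Wbar (chiBar Ω)

/-- The expression `(W^*)⁻¹ χ⁻¹`; here `W^* ∈ 𝒜_{++}`. -/
def adjWave (W : DiffOp Ω) : Osc Ω := applyExp (inv (bddBelow Ω) (adjoint W)) (-chi Ω)

/-- The expression `(W̄^*)⁻¹ χ̄⁻¹`; here `W̄^* ∈ 𝒜_{--}`. -/
def adjWaveBar (Wbar : DiffOp Ω) : Osc Ω :=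
  applyExp (inv (bddAbove Ω) (adjoint Wbar)) (-chiBar Ω)

/-- The dual wave function `ψ^* = Λ⁻¹ (W^*)⁻¹ Λ χ⁻¹`. In other words, `ψ^* = w^* χ⁻¹` with
`w^* = ∑_{j ≥ 0} w^*_j(s) z^{-j}` determined by `W⁻¹ = ∑_{j ≥ 0} Λ^{-j} ∘ w^*_j(s+1)`; this is
`z⁻¹ (W^*)⁻¹ χ⁻¹` with `s` replaced by `s-1`. With the shift of `s` by one step the products
`ψ(s') ψ^*(s)` and `ψ̄(s') ψ̄^*(s)` have the same residue (coefficient of `z⁻¹`) for all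
`s' - s ∈ ℤ`. -/
def dualWave (W : DiffOp Ω) : Osc Ω :=
  applyExp (lam (-1) * inv (bddBelow Ω) (adjoint W) * lam 1) (-chi Ω)

/-- The dual wave function `ψ̄^* = Λ⁻¹ (W̄^*)⁻¹ Λ χ̄⁻¹`, with the same shift of `s` by one step. -/
def dualWaveBar (Wbar : DiffOp Ω) : Osc Ω :=
  applyExp (lam (-1) * inv (bddAbove Ω) (adjoint Wbar) * lam 1) (-chiBar Ω)

/-! ### Tau-functions -/

/-- The coefficient of `u^n` in the Taylor expansion at `u = 0` of `f` with the variables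
`v_1, v_2, …` shifted to `v_1 + ε u, v_2 + ε u²/2, v_3 + ε u³/3, …`. Only `v_1, …, v_n` contribute
to it, so the shift is made in these variables. -/
def shiftCoeff (v : ℕ+ → TodaVar k m) (ε : 𝕜) (f : Fn Ω) (n : ℕ) : Fn Ω := fun p =>
  iteratedDeriv n
    (fun u : 𝕜 => f.ext (p.1 +
      ∑ i ∈ Finset.range n, (ε * u ^ (i + 1) / ((i + 1 : ℕ) : 𝕜)) • unitVec 𝕜 (v i.succPNat))) 0
    / (n.factorial : 𝕜)

/-- `f(s, t + ε[z⁻¹], t̄, x)` as a formal power series in `z⁻¹`, where all `t_1, t_2, …` are shifted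
and the `t̄_j` with `m ∤ j` are not. -/
def tShift (ε : 𝕜) (f : Fn Ω) : ZSeries Ω := fun n =>
  if n ≤ 0 then shiftCoeff TodaVar.t ε f (-n).toNat else 0

/-- `f(s, t, t̄ + ε[z], x)` as a formal power series in `z`, where all `t̄_1, t̄_2, …` are shifted
and the `t_i` with `k ∤ i` are not. -/
def tbarShift (ε : 𝕜) (f : Fn Ω) : ZSeries Ω := fun n =>
  if 0 ≤ n then shiftCoeff TodaVar.tbar ε f n.toNat else 0

/-- The quotient of a formal series by a function that does not depend on `z`. -/
def ZSeries.divFn (F : ZSeries Ω) (f : Fn Ω) : ZSeries Ω := fun n p => F n p / f p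

/-- `τ` is a tau-function of the solution with wave operators `W`, `W̄`:
`ψ = τ(s, t-[z⁻¹], t̄, x) / τ(s, t, t̄, x) · χ` and
`ψ̄ = τ(s+1, t, t̄+[z], x) / τ(s, t, t̄, x) · χ̄`. -/
structure IsTau (W Wbar : DiffOp Ω) (τ : Fn Ω) : Prop where
  smooth : τ.Smooth
  ne_zero : ∀ p, τ p ≠ 0
  wave_eq : wave W = ⟨ZSeries.divFn (tShift (-1) τ) τ, chi Ω⟩
  waveBar_eq : waveBar Wbar = ⟨ZSeries.divFn (tbarShift 1 (Fn.shift 1 τ)) τ, chiBar Ω⟩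

end EBTH

end

/-!
The proof uses, of all equations of the hierarchy, only the flows `∂W/∂tₙ = -(L^{n/k})_- W` and
`∂W̄/∂t̄ₙ = (L^{n/m})_+ W̄`. Both are Sato equations of one form. Let `Θ = Λ⁻¹` for `W` and `Θ = Λ`
for `W̄`, so that the operator is `W = ∑ wᵢ Θⁱ` with `i ≥ 0`. Up to a sign of the variables, the
equations are `Dₙ W = -(W Θ⁻ⁿ W⁻¹)_{≥ c} W`, where the projection keeps the powers `Θⁱ` with
`i ≥ c`, and `c = 1` for `W`, `c = 0` for `W̄`. Equivalently, `[Dₙ, W] + W Θ⁻ⁿ = Bₙ W`, where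
`Bₙ = (W Θ⁻ⁿ W⁻¹)_{< c}` has degree less than `c`.

Let `T = exp (∑ uⁿ Dₙ / n)` be the formal shift of the variables by `[u]`, a multiplicative
operation on functions, and consider the series `F(u) = T(W) (1 - u Θ⁻¹)⁻¹ W⁻¹` with `F(0) = 1`.
The Sato equations give `F'(u) = T(∑ Bₙ uⁿ⁻¹) F(u)`. Since the generator has degree less than
`c ≤ 1`, so has `F(u) - 1` (`dressing_degreeLE`). Write `W⁻¹ = ∑ Θʲ ∘ vⱼ`, and let `σ` be the
action of `Θ` on functions. As `(1 - u Θ⁻¹)⁻¹` is a geometric series, the coefficient of `Θᶜ` in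
`F(u)` says that the series `∑ T(wᵢ) uⁱ` and `∑ σᶜ(vⱼ) uʲ` are inverse to each other
(`dressing_inverse`; for `c = 1` this uses `w₀ = 1`). This is the bilinear identity that is needed,
without residues. If now `∑ wᵢ uⁱ = T⁻¹(ρ) / τ`, where `ρ` is `τ` or `Λ τ`, then
`∑ T(wᵢ) uⁱ = ρ / T(τ)` and therefore `∑ σᶜ(vⱼ) uʲ = T(τ) / ρ` (`dressing_inverse_tau`). The `vⱼ`
are the coefficients of `(W^*)⁻¹ χ⁻¹`, or of `(W̄^*)⁻¹ χ̄⁻¹`, and the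
claim follows.

To multiply difference operators, derivations and shifts freely, these are placed in one
associative ring, the Laurent series over the endomorphisms of the algebra of smooth functions
(`OpSeries`). The rest is the translation: Taylor coefficients along the curve `v + ε[u]` are given
by the formal shift (`iteratedDeriv_curve`), `OpSeries` maps to difference operators
(`toDiffOp_mul`), and inverses are unique there (`DiffOp.inv_eq`). `sato_inverse` states the result
for a difference operator, and `adjWave_eq` and `adjWaveBar_eq` apply it to `W` and `W̄`.
-/

noncomputable section

namespace EBTH
open PowerSeries Finset

/-! ### Linear differential equations for formal power series -/

/-- The termwise derivative of a power series over a ring that need not be commutative. -/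
def termDeriv {A : Type*} [Ring A] (y : A⟦X⟧) : A⟦X⟧ :=
  PowerSeries.mk fun n => (n + 1) • coeff (n + 1) y

section ODE
variable {A B : Type*} [Ring A] [Ring B]

theorem coeff_termDeriv (y : A⟦X⟧) (n : ℕ) :
    coeff n (termDeriv y) = (n + 1) • coeff (n + 1) y := by
  simp [termDeriv]

theorem termDeriv_C (a : A) : termDeriv (C a : A⟦X⟧) = 0 := by
  ext n; simp [coeff_termDeriv]

theorem termDeriv_map (f : A →+* B) (y : A⟦X⟧) :
    termDeriv (PowerSeries.map f y) = PowerSeries.map f (termDeriv y) := by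
  ext n; simp [coeff_termDeriv]

theorem termDeriv_mul (y z : A⟦X⟧) :
    termDeriv (y * z) = termDeriv y * z + y * termDeriv z := by
  ext n
  have h1 := Nat.sum_antidiagonal_succ (n := n)
    (f := fun p : ℕ × ℕ => p.1 • (coeff p.1 y * coeff p.2 z))
  have h2 := Nat.sum_antidiagonal_succ' (n := n)
    (f := fun p : ℕ × ℕ => p.2 • (coeff p.1 y * coeff p.2 z))
  have h3 : (n + 1) • coeff (n + 1) (y * z) =
      ∑ p ∈ antidiagonal (n + 1), p.1 • (coeff p.1 y * coeff p.2 z) +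
      ∑ p ∈ antidiagonal (n + 1), p.2 • (coeff p.1 y * coeff p.2 z) := by
    rw [coeff_mul, smul_sum, ← sum_add_distrib]
    refine sum_congr rfl fun p hp => ?_
    rw [← add_smul, mem_antidiagonal.1 hp]
  rw [coeff_termDeriv, h3, h1, h2, map_add, coeff_mul, coeff_mul]
  simp only [coeff_termDeriv, smul_mul_assoc, mul_smul_comm, zero_smul, zero_add]

theorem nsmul_succ_cancel (𝕜 : Type*) [Field 𝕜] [CharZero 𝕜] {M : Type*} [AddCommGroup M]
    [Module 𝕜 M] {n : ℕ} {a : M} (h : (n + 1) • a = 0) : a = 0 := by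
  rw [← Nat.cast_smul_eq_nsmul 𝕜] at h
  exact (smul_eq_zero.1 h).resolve_left (Nat.cast_ne_zero.2 n.succ_ne_zero)

/-- A solution of the linear equation `y' = x y` is determined by its constant term. -/
theorem termDeriv_eq_mul_unique (𝕜 : Type*) [Field 𝕜] [CharZero 𝕜] [Algebra 𝕜 A]
    {x y z : A⟦X⟧} (hy : termDeriv y = x * y) (hz : termDeriv z = x * z)
    (h0 : coeff 0 y = coeff 0 z) : y = z := by
  ext n
  induction n using Nat.strong_induction_on with
  | _ n ih =>
    cases n with
    | zero => exact h0
    | succ n =>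
      rw [← sub_eq_zero]
      refine nsmul_succ_cancel 𝕜 (n := n) ?_
      rw [smul_sub, ← coeff_termDeriv, ← coeff_termDeriv, hy, hz, coeff_mul, coeff_mul, sub_eq_zero]
      refine sum_congr rfl fun p hp => ?_
      rw [ih p.2 (by have := mem_antidiagonal.1 hp; omega)]

/-- The coefficients of the solution of `y' = x y`, `y(0) = 1`, by the recursion
`(n + 1) yₙ₊₁ = ∑ xₙ₋ᵢ yᵢ`. -/
def evolCoeff (𝕜 : Type*) [Field 𝕜] [Algebra 𝕜 A] (x : A⟦X⟧) : ℕ → A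
  | 0 => 1
  | n + 1 => ((n + 1 : ℕ) : 𝕜)⁻¹ • ∑ i : Fin (n + 1), coeff (n - i) x * evolCoeff 𝕜 x i

/-- The solution of `y' = x y`, `y(0) = 1`. -/
def evol (𝕜 : Type*) [Field 𝕜] [Algebra 𝕜 A] (x : A⟦X⟧) : A⟦X⟧ := PowerSeries.mk (evolCoeff 𝕜 x)

theorem coeff_zero_evol (𝕜 : Type*) [Field 𝕜] [Algebra 𝕜 A] (x : A⟦X⟧) :
    coeff 0 (evol 𝕜 x) = 1 := by
  rw [evol, coeff_mk, evolCoeff]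

theorem termDeriv_evol (𝕜 : Type*) [Field 𝕜] [CharZero 𝕜] [Algebra 𝕜 A] (x : A⟦X⟧) :
    termDeriv (evol 𝕜 x) = x * evol 𝕜 x := by
  ext n
  rw [coeff_termDeriv, coeff_mul, evol, coeff_mk, evolCoeff, ← Nat.cast_smul_eq_nsmul 𝕜,
    smul_inv_smul₀ (Nat.cast_ne_zero.2 n.succ_ne_zero),
    ← Nat.sum_antidiagonal_swap, Nat.sum_antidiagonal_eq_sum_range_succ_mk, sum_range]
  simp

end ODE

/-! ### Shifts of infinitely many variables as formal exponentials -/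

section Shift
variable {𝕜 : Type*} [Field 𝕜] {R : Type*} [CommRing R] [Algebra 𝕜 R]

/-- The operator of multiplication by a function. -/
abbrev mulOp (𝕜 : Type*) [Field 𝕜] {R : Type*} [CommRing R] [Algebra 𝕜 R] :
    R →ₐ[𝕜] Module.End 𝕜 R := Algebra.lmul 𝕜 R

theorem mulOp_apply (a b : R) : mulOp 𝕜 a b = a * b := rfl

/-- The generating series `∑ Dᵢ uⁱ`. -/
def derivSeries (D : ℕ → Derivation 𝕜 R R) : (Module.End 𝕜 R)⟦X⟧ :=
  PowerSeries.mk fun i => (D i : R →ₗ[𝕜] R)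

/-- The formal shift `exp (∑ uⁱ⁺¹ Dᵢ / (i + 1))`, defined as the solution of `T' = (∑ Dᵢ uⁱ) T`. -/
def shiftSeries (D : ℕ → Derivation 𝕜 R R) : (Module.End 𝕜 R)⟦X⟧ := evol 𝕜 (derivSeries D)

theorem constantCoeff_shiftSeries (D : ℕ → Derivation 𝕜 R R) :
    constantCoeff (shiftSeries D) = 1 := by
  rw [← coeff_zero_eq_constantCoeff_apply]
  exact coeff_zero_evol _ _

theorem termDeriv_shiftSeries [CharZero 𝕜] (D : ℕ → Derivation 𝕜 R R) :
    termDeriv (shiftSeries D) = derivSeries D * shiftSeries D := termDeriv_evol _ _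

/-- The series of operators of multiplication by the coefficients of `T a`. -/
def shiftMul (D : ℕ → Derivation 𝕜 R R) (a : R) : (Module.End 𝕜 R)⟦X⟧ :=
  PowerSeries.mk fun n => mulOp 𝕜 (coeff n (shiftSeries D) a)

theorem nsmul_coeff_shiftSeries_apply [CharZero 𝕜] (D : ℕ → Derivation 𝕜 R R) (n : ℕ) (a : R) :
    (n + 1) • coeff (n + 1) (shiftSeries D) a =
      ∑ p ∈ antidiagonal n, D p.1 (coeff p.2 (shiftSeries D) a) := by
  have h := congrArg (fun y : (Module.End 𝕜 R)⟦X⟧ => (coeff n y : Module.End 𝕜 R) a)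
      (termDeriv_shiftSeries D)
  simp only [coeff_termDeriv, coeff_mul, LinearMap.smul_apply, LinearMap.sum_apply,
    Module.End.mul_apply] at h
  simpa [derivSeries] using h

theorem deriv_comm_mulOp (d : Derivation 𝕜 R R) (a : R) :
    mulOp 𝕜 (d a) = (d : Module.End 𝕜 R) * mulOp 𝕜 a - mulOp 𝕜 a * (d : Module.End 𝕜 R) := by
  ext b
  simp [Module.End.mul_apply, mul_comm]

/-- The formal shift is multiplicative: as operators, `T ∘ a = (T a) ∘ T`. Both sides solve
`y' = (∑ Dᵢ uⁱ) y`, since the `Dᵢ` are derivations. -/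
theorem shiftSeries_mul_C [CharZero 𝕜] (D : ℕ → Derivation 𝕜 R R) (a : R) :
    shiftSeries D * C (mulOp 𝕜 a) = shiftMul D a * shiftSeries D := by
  refine termDeriv_eq_mul_unique 𝕜 (x := derivSeries D) ?_ ?_ ?_
  · rw [termDeriv_mul, termDeriv_C, termDeriv_shiftSeries, mul_zero, add_zero, mul_assoc]
  · have h : termDeriv (shiftMul D a) =
        derivSeries D * shiftMul D a - shiftMul D a * derivSeries D := by
      ext1 n
      rw [map_sub, coeff_mul, coeff_mul, coeff_termDeriv, shiftMul, coeff_mk, ← map_nsmul,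
        nsmul_coeff_shiftSeries_apply, map_sum, ← Nat.sum_antidiagonal_swap (n := n)
          (f := fun p => coeff p.1 (PowerSeries.mk _) * coeff p.2 (derivSeries D)),
        ← sum_sub_distrib]
      refine sum_congr rfl fun p _ => ?_
      rw [deriv_comm_mulOp]
      simp [derivSeries]
    rw [termDeriv_mul, h, termDeriv_shiftSeries, sub_mul, mul_assoc, mul_assoc, sub_add_cancel]
  · simp [constantCoeff_shiftSeries, shiftMul]

/-- An operator that commutes with all `Dᵢ` commutes with the formal shift: both products solve
`y' = (∑ Dᵢ uⁱ) y`. -/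
theorem commute_coeff_shiftSeries [CharZero 𝕜] {D : ℕ → Derivation 𝕜 R R} {X : Module.End 𝕜 R}
    (hX : ∀ i, Commute X (D i : Module.End 𝕜 R)) (n : ℕ) : Commute X (coeff n (shiftSeries D)) := by
  have h : C X * shiftSeries D = shiftSeries D * C X := by
    refine termDeriv_eq_mul_unique 𝕜 (x := derivSeries D) ?_ ?_ ?_
    · have : C X * derivSeries D = derivSeries D * C X := by
        ext1 n; simpa [derivSeries] using (hX n).eq
      rw [termDeriv_mul, termDeriv_C, termDeriv_shiftSeries, zero_mul, zero_add, ← mul_assoc, this,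
        mul_assoc]
    · rw [termDeriv_mul, termDeriv_C, termDeriv_shiftSeries, mul_zero, add_zero, mul_assoc]
    · simp [constantCoeff_shiftSeries]
  rw [commute_iff_eq]
  simpa using congrArg (coeff n) h

theorem commute_derivSeries_shiftSeries [CharZero 𝕜] {D D' : ℕ → Derivation 𝕜 R R}
    (hD : ∀ i j, Commute (D i : Module.End 𝕜 R) (D' j : Module.End 𝕜 R)) :
    Commute (derivSeries D) (shiftSeries D') := by
  ext1 n
  rw [coeff_mul, coeff_mul, ← Nat.sum_antidiagonal_swap]
  refine sum_congr rfl fun p _ => ?_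
  simpa [derivSeries] using (commute_coeff_shiftSeries (hD p.2) p.1).eq

/-- The shifts along `-D` and `D` are inverse to each other: their product has derivative zero. -/
theorem shiftSeries_neg_mul [CharZero 𝕜] (D : ℕ → Derivation 𝕜 R R)
    (hD : ∀ i j, Commute (D i : Module.End 𝕜 R) (D j : Module.End 𝕜 R)) :
    shiftSeries (fun i => -D i) * shiftSeries D = 1 := by
  have hn : derivSeries (fun i => -D i) + derivSeries D = 0 := by ext1 n; simp [derivSeries]
  refine termDeriv_eq_mul_unique 𝕜 (x := 0) ?_ ?_ ?_
  · rw [termDeriv_mul, termDeriv_shiftSeries, termDeriv_shiftSeries, ← mul_assoc,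
      ← (commute_derivSeries_shiftSeries (D' := fun i => -D i) fun i j => ?_).eq]
    · rw [← add_mul, ← add_mul, hn, zero_mul, zero_mul, zero_mul]
    · rw [Derivation.coe_neg_linearMap]
      exact (hD i j).neg_right
  · rw [← map_one C, termDeriv_C, zero_mul]
  · simp [constantCoeff_shiftSeries]

theorem shiftSeries_mul_neg [CharZero 𝕜] (D : ℕ → Derivation 𝕜 R R)
    (hD : ∀ i j, Commute (D i : Module.End 𝕜 R) (D j : Module.End 𝕜 R)) :
    shiftSeries D * shiftSeries (fun i => -D i) = 1 := by
  have := shiftSeries_neg_mul (fun i => -D i) fun i j => by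
    rw [Derivation.coe_neg_linearMap, Derivation.coe_neg_linearMap]
    exact (hD i j).neg_left.neg_right
  simpa using this

/-- The formal shift fixes the constants, i.e. `T 1 = 1`. -/
theorem coeff_succ_shiftSeries_one [CharZero 𝕜] (D : ℕ → Derivation 𝕜 R R)
    (hD : ∀ i j, Commute (D i : Module.End 𝕜 R) (D j : Module.End 𝕜 R)) (n : ℕ) :
    coeff (n + 1) (shiftSeries D) (1 : R) = 0 := by
  have h : shiftMul D 1 = 1 := by
    calc shiftMul D 1 = shiftMul D 1 * shiftSeries D * shiftSeries (fun i => -D i) := by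
          rw [mul_assoc, shiftSeries_mul_neg D hD, mul_one]
      _ = 1 := by
          rw [← shiftSeries_mul_C, map_one, map_one, mul_one, shiftSeries_mul_neg D hD]
  have h' := congrArg (fun x : (Module.End 𝕜 R)⟦X⟧ => (coeff (n + 1) x : Module.End 𝕜 R) 1) h
  simpa [shiftMul, coeff_one] using h'

end Shift
/-! ### Difference operators as Laurent series -/

section Operators
variable {𝕜 : Type*} [Field 𝕜] {R : Type*} [CommRing R] [Algebra 𝕜 R]

/-- The ring in which the difference operators are multiplied: formal Laurent series in a central
variable with coefficients in the endomorphisms of the space of functions. The operator `a Θⁱ` is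
the monomial of degree `i` with coefficient `f ↦ a σⁱ(f)`. It also contains the derivations, in
degree zero. -/
abbrev OpSeries (𝕜 R : Type*) [Field 𝕜] [CommRing R] [Algebra 𝕜 R] : Type _ :=
  HahnSeries ℤ (Module.End 𝕜 R)

/-- The operator `σⁱ`, `i ∈ ℤ`, on functions. -/
def shiftOp (σ : R ≃ₐ[𝕜] R) (i : ℤ) : Module.End 𝕜 R := (σ ^ i).toLinearMap

theorem shiftOp_apply (σ : R ≃ₐ[𝕜] R) (i : ℤ) (a : R) : shiftOp σ i a = (σ ^ i) a := rfl

theorem shiftOp_zero (σ : R ≃ₐ[𝕜] R) : shiftOp σ 0 = 1 := by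
  ext; simp [shiftOp_apply]

theorem shiftOp_add (σ : R ≃ₐ[𝕜] R) (i j : ℤ) : shiftOp σ (i + j) = shiftOp σ i * shiftOp σ j := by
  ext; simp [shiftOp_apply, zpow_add]

theorem shiftOp_mul_mulOp (σ : R ≃ₐ[𝕜] R) (i : ℤ) (a : R) :
    shiftOp σ i * mulOp 𝕜 a = mulOp 𝕜 ((σ ^ i) a) * shiftOp σ i := by
  ext; simp [shiftOp_apply]

theorem commute_shiftOp {σ : R ≃ₐ[𝕜] R} {d : Module.End 𝕜 R} (h : ∀ a, d (σ a) = σ (d a)) (i : ℤ) :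
    Commute (shiftOp σ i) d := by
  have h1 : Commute (shiftOp σ 1) d := by
    ext a; simp [shiftOp_apply, h]
  have h2 : Commute (shiftOp σ (-1)) d := by
    have e1 : shiftOp σ (-1) * shiftOp σ 1 = 1 := by rw [← shiftOp_add]; exact shiftOp_zero σ
    have e2 : shiftOp σ 1 * shiftOp σ (-1) = 1 := by rw [← shiftOp_add]; exact shiftOp_zero σ
    calc shiftOp σ (-1) * d = shiftOp σ (-1) * (d * shiftOp σ 1) * shiftOp σ (-1) := by
          rw [mul_assoc, mul_assoc, e2, mul_one]
      _ = d * shiftOp σ (-1) := by rw [← h1.eq, ← mul_assoc, e1, one_mul]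
  induction i using Int.induction_on with
  | zero => rw [shiftOp_zero]; exact Commute.one_left d
  | succ i ih => rw [shiftOp_add]; exact ih.mul_left h1
  | pred i ih => rw [sub_eq_add_neg, shiftOp_add]; exact ih.mul_left h2

/-- The operator `Θⁱ`: the automorphism `σⁱ`, placed in degree `i`. -/
def thetaPow (σ : R ≃ₐ[𝕜] R) (i : ℤ) : OpSeries 𝕜 R := HahnSeries.single i (shiftOp σ i)

theorem thetaPow_zero (σ : R ≃ₐ[𝕜] R) : thetaPow σ 0 = 1 := by
  rw [thetaPow, shiftOp_zero]; rfl

theorem thetaPow_mul (σ : R ≃ₐ[𝕜] R) (i j : ℤ) :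
    thetaPow σ i * thetaPow σ j = thetaPow σ (i + j) := by
  simp [thetaPow, shiftOp_add]

/-- The operator `∑ aᵢ Θⁱ`, as a power series. -/
def opPower (σ : R ≃ₐ[𝕜] R) (a : ℕ → R) : (Module.End 𝕜 R)⟦X⟧ :=
  PowerSeries.mk fun i => mulOp 𝕜 (a i) * shiftOp σ i

/-- All powers of `Θ` in the operator are at most `d`. -/
def DegreeLE (d : ℤ) (x : OpSeries 𝕜 R) : Prop := ∀ i, d < i → x.coeff i = 0

theorem DegreeLE.mono {d e : ℤ} {x : OpSeries 𝕜 R} (h : DegreeLE d x) (hde : d ≤ e) :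
    DegreeLE e x := fun i hi => h i (hde.trans_lt hi)

theorem DegreeLE.mul {d e : ℤ} {x y : OpSeries 𝕜 R} (hx : DegreeLE d x) (hy : DegreeLE e y) :
    DegreeLE (d + e) (x * y) := by
  intro n hn
  rw [HahnSeries.coeff_mul]
  refine sum_eq_zero fun p hp => ?_
  have hp' := (Finset.mem_antidiagonal.1 hp).2.2
  rcases lt_or_ge d p.1 with h | h
  · rw [hx _ h, zero_mul]
  · rw [hy p.2 (by omega), mul_zero]

theorem DegreeLE.sum {ι : Type*} {d : ℤ} {s : Finset ι} {x : ι → OpSeries 𝕜 R}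
    (h : ∀ i ∈ s, DegreeLE d (x i)) : DegreeLE d (∑ i ∈ s, x i) := by
  intro n hn
  rw [HahnSeries.coeff_sum]
  exact sum_eq_zero fun i hi => h i hi n hn

theorem degreeLE_C (a : Module.End 𝕜 R) : DegreeLE 0 (HahnSeries.C a) := by
  intro i hi
  rw [HahnSeries.C_apply, HahnSeries.coeff_single_of_ne hi.ne']

theorem degreeLE_one : DegreeLE 0 (1 : OpSeries 𝕜 R) := by
  simpa using degreeLE_C (1 : Module.End 𝕜 R)

/-- The coefficient of `Θᶜ` in `(∑ aᵢ Θⁱ) Θ⁻ᵇ (∑ Θʲ vⱼ)`. -/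
theorem coeff_opPower_mul_thetaPow_mul_apply_one (σ : R ≃ₐ[𝕜] R) (a v : ℕ → R) (b c : ℕ) :
    (HahnSeries.ofPowerSeries ℤ _ (opPower σ a) * thetaPow σ (-(b : ℤ)) *
      HahnSeries.ofPowerSeries ℤ _ (opPower σ fun j => (σ ^ (j : ℤ)) (v j))).coeff (c : ℤ) 1 =
    ∑ p ∈ antidiagonal (b + c), a p.1 * (σ ^ (c : ℤ)) (v p.2) := by
  have h : HahnSeries.ofPowerSeries ℤ _ (opPower σ a) * thetaPow σ (-(b : ℤ)) =
      HahnSeries.single (-(b : ℤ)) 1 *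
        HahnSeries.ofPowerSeries ℤ _ (opPower σ a * C (shiftOp σ (-(b : ℤ)))) := by
    ext1
    ext1 n
    rw [thetaPow, HahnSeries.coeff_mul_single, HahnSeries.coeff_single_mul, map_mul,
      HahnSeries.ofPowerSeries_C, HahnSeries.C_apply, HahnSeries.coeff_mul_single_zero, one_mul]
  have hcb : ((c : ℤ) - -(b : ℤ)) = ((b + c : ℕ) : ℤ) := by push_cast; ring
  rw [h, mul_assoc, HahnSeries.coeff_single_mul, one_mul, ← map_mul, hcb,
    HahnSeries.ofPowerSeries_apply_coeff, coeff_mul, LinearMap.sum_apply]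
  refine sum_congr rfl fun p hp => ?_
  have hp' : (c : ℤ) = p.1 + -(b : ℤ) + p.2 := by
    have := mem_antidiagonal.1 hp
    omega
  rw [hp', zpow_add, zpow_add]
  simp [opPower, shiftOp_apply]

end Operators

/-! ### The shifted dressing operator -/

theorem coeff_zero_dressing {A : Type*} [Ring A] (T T' G : A⟦X⟧) (W V : A) :
    coeff 0 (T * C W * G * T' * C V) = coeff 0 T * W * coeff 0 G * coeff 0 T' * V := by
  simp

/-- If the derivatives of `T`, `T⁻¹` and `G` are `T δ`, `-δ T⁻¹` and `g G`, and `W` satisfies the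
flow equation `[δ, W] + W g = b W`, then the derivative of `F = T W G T⁻¹ V` is `(T b T⁻¹) F`. -/
theorem termDeriv_dressing {A : Type*} [Ring A] {T T' δ G g b : A⟦X⟧} {W : A} (V : A)
    (hdT : termDeriv T = T * δ) (hdT' : termDeriv T' + δ * T' = 0) (hdG : termDeriv G = g * G)
    (hGδ : G * δ = δ * G) (hT'T : T' * T = 1)
    (hflow : δ * C W + C W * g = b * C W + C W * δ) :
    termDeriv (T * C W * G * T' * C V) = T * b * T' * (T * C W * G * T' * C V) := by
  have e1 : termDeriv (G * T') + δ * (G * T') = g * (G * T') := by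
    rw [termDeriv_mul, hdG, ← mul_assoc δ, ← hGδ, mul_assoc G, add_assoc, ← mul_add, hdT',
      mul_zero, add_zero, mul_assoc]
  have e2 : termDeriv (T * C W * G * T' * C V) =
      T * δ * C W * (G * T') * C V + T * C W * termDeriv (G * T') * C V := by
    have : T * C W * G * T' * C V = T * C W * (G * T') * C V := by simp only [mul_assoc]
    rw [this, termDeriv_mul, termDeriv_C, mul_zero, add_zero, termDeriv_mul, termDeriv_mul,
      termDeriv_C, mul_zero, add_zero, hdT, add_mul]
  have e3 : T * b * T' * (T * C W * G * T' * C V) = T * (b * C W) * (G * T') * C V := by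
    calc _ = T * b * (T' * T) * C W * G * T' * C V := by simp only [mul_assoc]
      _ = _ := by rw [hT'T, mul_one]; simp only [mul_assoc]
  refine add_right_cancel (b := T * C W * (δ * (G * T')) * C V) ?_
  calc _ = T * (δ * C W) * (G * T') * C V +
          T * C W * (termDeriv (G * T') + δ * (G * T')) * C V := by
        rw [e2, mul_add, add_mul, ← add_assoc]; simp only [mul_assoc]
    _ = T * (δ * C W + C W * g) * (G * T') * C V := by
        rw [e1, mul_add, add_mul, add_mul]; simp only [mul_assoc]
    _ = _ := by
        rw [hflow, e3, mul_add, add_mul, add_mul]; simp only [mul_assoc]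

section Dressing
variable {𝕜 : Type*} [Field 𝕜] [CharZero 𝕜] {R : Type*} [CommRing R] [Algebra 𝕜 R]

theorem sum_antidiagonal_triple {M : Type*} [AddCommMonoid M] (f : ℕ → ℕ → ℕ → M) (n : ℕ) :
    ∑ p ∈ antidiagonal n, ∑ q ∈ antidiagonal p.1, f q.1 q.2 p.2 =
      ∑ p ∈ antidiagonal n, ∑ q ∈ antidiagonal p.2, f p.1 q.1 q.2 := by
  rw [sum_sigma', sum_sigma']
  refine sum_nbij' (fun x => ⟨(x.2.1, x.2.2 + x.1.2), (x.2.2, x.1.2)⟩)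
    (fun x => ⟨(x.1.1 + x.2.1, x.2.2), (x.1.1, x.2.1)⟩) ?_ ?_ ?_ ?_ ?_
  · rintro ⟨⟨a, b⟩, ⟨d, e⟩⟩
    simp only [mem_sigma, HasAntidiagonal.mem_antidiagonal]
    rintro ⟨rfl, rfl⟩
    exact ⟨by omega, trivial⟩
  · rintro ⟨⟨a, b⟩, ⟨d, e⟩⟩
    simp only [mem_sigma, HasAntidiagonal.mem_antidiagonal]
    rintro ⟨rfl, rfl⟩
    exact ⟨by omega, trivial⟩
  · rintro ⟨⟨a, b⟩, ⟨d, e⟩⟩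
    simp only [mem_sigma, HasAntidiagonal.mem_antidiagonal]
    rintro ⟨-, rfl⟩
    rfl
  · rintro ⟨⟨a, b⟩, ⟨d, e⟩⟩
    simp only [mem_sigma, HasAntidiagonal.mem_antidiagonal]
    rintro ⟨-, rfl⟩
    rfl
  · rintro ⟨⟨a, b⟩, ⟨d, e⟩⟩ _
    rfl

/-- The shift of a difference operator is the shift of its coefficients: `T ∘ W = T(W) ∘ T`. -/
theorem shiftSeries_mul_C_opPower {σ : R ≃ₐ[𝕜] R} {D : ℕ → Derivation 𝕜 R R}
    (hσ : ∀ i a, D i (σ a) = σ (D i a)) (w : ℕ → R) :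
    PowerSeries.map HahnSeries.C (shiftSeries D) *
        C (HahnSeries.ofPowerSeries ℤ _ (opPower σ w)) =
      (PowerSeries.mk fun n => HahnSeries.ofPowerSeries ℤ _
          (opPower σ fun i => coeff n (shiftSeries D) (w i))) *
        PowerSeries.map HahnSeries.C (shiftSeries D) := by
  ext1 n
  rw [coeff_mul_C, coeff_mul, coeff_map, ← HahnSeries.ofPowerSeries_C, ← map_mul]
  simp only [coeff_mk, coeff_map, ← HahnSeries.ofPowerSeries_C, ← map_mul, ← map_sum]
  congr 1
  ext1 i
  have h := congrArg (coeff n) (shiftSeries_mul_C D (w i))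
  rw [coeff_mul_C, coeff_mul] at h
  rw [map_sum, coeff_C_mul, opPower, coeff_mk, ← mul_assoc, h, sum_mul]
  refine sum_congr rfl fun p _ => ?_
  rw [coeff_mul_C, opPower, coeff_mk, mul_assoc, mul_assoc, shiftMul, coeff_mk,
    (commute_coeff_shiftSeries (fun j => commute_shiftOp (hσ j) i) p.2).eq]

/-- Let `W = ∑ wᵢ Θⁱ` with inverse `V = ∑ Θʲ vⱼ` satisfy the Sato equations
`Dₙ W = Bₙ W - W Θ⁻ⁿ⁻¹` with `Bₙ` of degree less than `c`. With `T` the formal shift along the `Dₙ`,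
all coefficients of the series `T(W) (1 - u Θ⁻¹)⁻¹ V`, except the constant one, which is `1`, have
degree less than `c`. Indeed the series solves a linear differential equation in `u` whose generator
`T(∑ Bₙ uⁿ)` has degree less than `c`. -/
theorem dressing_degreeLE (σ : R ≃ₐ[𝕜] R) (D : ℕ → Derivation 𝕜 R R)
    (hσ : ∀ i a, D i (σ a) = σ (D i a))
    (hD : ∀ i j, Commute (D i : Module.End 𝕜 R) (D j : Module.End 𝕜 R))
    (c : ℤ) (hc : c ≤ 1) (w : ℕ → R) (V : OpSeries 𝕜 R) (B : ℕ → OpSeries 𝕜 R)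
    (hWV : HahnSeries.ofPowerSeries ℤ _ (opPower σ w) * V = 1)
    (hB : ∀ i, DegreeLE (c - 1) (B i))
    (hflow : ∀ i : ℕ, HahnSeries.C (D i : Module.End 𝕜 R) *
        HahnSeries.ofPowerSeries ℤ _ (opPower σ w) +
        HahnSeries.ofPowerSeries ℤ _ (opPower σ w) * thetaPow σ (-((i + 1 : ℕ) : ℤ)) =
      B i * HahnSeries.ofPowerSeries ℤ _ (opPower σ w) +
        HahnSeries.ofPowerSeries ℤ _ (opPower σ w) * HahnSeries.C (D i : Module.End 𝕜 R))
    (n : ℕ) (i : ℤ) (hi : c ≤ i) :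
    (∑ p ∈ antidiagonal n,
      HahnSeries.ofPowerSeries ℤ _ (opPower σ fun i => coeff p.1 (shiftSeries D) (w i)) *
        thetaPow σ (-(p.2 : ℤ)) * V).coeff i =
      if n = 0 then (1 : OpSeries 𝕜 R).coeff i else 0 := by
  set W : OpSeries 𝕜 R := HahnSeries.ofPowerSeries ℤ _ (opPower σ w) with hW
  set CH : Module.End 𝕜 R →+* OpSeries 𝕜 R := HahnSeries.C with hCH
  set T := PowerSeries.map CH (shiftSeries D) with hT
  set T' := PowerSeries.map CH (shiftSeries fun i => -D i) with hT'
  set δ := PowerSeries.map CH (derivSeries D) with hδ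
  set G : (OpSeries 𝕜 R)⟦X⟧ := PowerSeries.mk fun b => thetaPow σ (-(b : ℤ)) with hG
  set g : (OpSeries 𝕜 R)⟦X⟧ := PowerSeries.mk fun i => thetaPow σ (-((i + 1 : ℕ) : ℤ)) with hg
  set b : (OpSeries 𝕜 R)⟦X⟧ := PowerSeries.mk B with hb
  have hTT' : T * T' = 1 := by rw [← map_mul, shiftSeries_mul_neg D hD, map_one]
  have hT'T : T' * T = 1 := by rw [← map_mul, shiftSeries_neg_mul D hD, map_one]
  have hdT : termDeriv T = T * δ := by
    rw [hT, termDeriv_map, termDeriv_shiftSeries, (commute_derivSeries_shiftSeries hD).eq, map_mul]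
  have hdT' : termDeriv T' + δ * T' = 0 := by
    have : derivSeries (fun i => -D i) + derivSeries D = 0 := by ext1 n; simp [derivSeries]
    rw [hT', termDeriv_map, termDeriv_shiftSeries, ← map_mul, ← map_add, ← add_mul, this, zero_mul,
      map_zero]
  have hdG : termDeriv G = g * G := by
    ext1 n
    refine (coeff_termDeriv G n).trans ?_
    rw [coeff_mul]
    simp only [hG, hg, coeff_mk, thetaPow_mul]
    rw [sum_congr rfl (g := fun _ => thetaPow σ (-((n + 1 : ℕ) : ℤ)))]
    · simp
    · intro p hp
      have := mem_antidiagonal.1 hp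
      congr 1
      omega
  have hθ : ∀ (d : Module.End 𝕜 R) (_ : ∀ i, Commute (shiftOp σ i) d) (i : ℤ),
      thetaPow σ i * CH d = CH d * thetaPow σ i := by
    intro d hd i
    rw [thetaPow, hCH, HahnSeries.C_apply, HahnSeries.single_mul_single,
      HahnSeries.single_mul_single, (hd i).eq, zero_add, add_zero]
  have hGδ : G * δ = δ * G := by
    ext1 n
    rw [coeff_mul, coeff_mul, ← Nat.sum_antidiagonal_swap]
    refine sum_congr rfl fun p _ => ?_
    simpa [hG, hδ, derivSeries] using hθ _ (commute_shiftOp (hσ _)) _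
  have hGT' : G * T' = T' * G := by
    ext1 n
    rw [coeff_mul, coeff_mul, ← Nat.sum_antidiagonal_swap]
    refine sum_congr rfl fun p _ => ?_
    simpa [hG, hT'] using hθ _ (fun i => commute_coeff_shiftSeries (fun j =>
      commute_shiftOp (fun a => by simp [hσ]) i) _) _
  have hfl : δ * C W + C W * g = b * C W + C W * δ := by
    ext1 i
    have := hflow i
    simpa [hδ, hb, hg, derivSeries] using this
  -- As `G = (1 - u Θ⁻¹)⁻¹` commutes with `T`, this is `T(W) G V`.
  set F := T * C W * G * T' * C V with hF
  have hdF : termDeriv F = T * b * T' * F := termDeriv_dressing V hdT hdT' hdG hGδ hT'T hfl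
  have hF0 : coeff 0 F = 1 := by
    have h1 : coeff 0 T = 1 := by
      rw [hT, coeff_map, coeff_zero_eq_constantCoeff_apply, constantCoeff_shiftSeries, map_one]
    have h2 : coeff 0 T' = 1 := by
      rw [hT', coeff_map, coeff_zero_eq_constantCoeff_apply, constantCoeff_shiftSeries, map_one]
    have h3 : coeff 0 G = 1 := by
      rw [hG, coeff_mk, Nat.cast_zero, neg_zero, thetaPow_zero]
    refine (coeff_zero_dressing T T' G W V).trans ?_
    rw [h1, h2, h3, one_mul, mul_one, mul_one, hWV]
  have hFn : coeff n F = ∑ p ∈ antidiagonal n,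
      HahnSeries.ofPowerSeries ℤ _ (opPower σ fun i => coeff p.1 (shiftSeries D) (w i)) *
        thetaPow σ (-(p.2 : ℤ)) * V := by
    have : F = (PowerSeries.mk fun n => HahnSeries.ofPowerSeries ℤ _
          (opPower σ fun i => coeff n (shiftSeries D) (w i))) * G * C V := by
      rw [hF, mul_assoc _ G, hGT', ← mul_assoc, shiftSeries_mul_C_opPower hσ,
        mul_assoc _ _ T', hTT', mul_one]
    rw [this, coeff_mul_C, coeff_mul, sum_mul]
    simp [hG]
  rw [← hFn]
  clear hFn
  -- Conjugation by `T` preserves degrees, because `T` consists of operators of degree zero.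
  have hTbT' : ∀ n, DegreeLE (c - 1) (coeff n (T * b * T')) := by
    intro n
    rw [coeff_mul]
    refine DegreeLE.sum fun p _ => ?_
    rw [coeff_mul]
    refine DegreeLE.mono (DegreeLE.mul (d := c - 1) (e := 0) (DegreeLE.sum fun q _ => ?_) ?_)
      (by omega)
    · refine DegreeLE.mono (DegreeLE.mul (d := 0) (e := c - 1) ?_ ?_) (by omega)
      · rw [hT, coeff_map]; exact degreeLE_C _
      · rw [hb, coeff_mk]; exact hB _
    · rw [hT', coeff_map]; exact degreeLE_C _
  induction n using Nat.strong_induction_on generalizing i with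
  | _ n ih =>
    cases n with
    | zero => rw [hF0, if_pos rfl]
    | succ n =>
      -- The lower coefficients have degree at most `0`, since `c ≤ 1`; hence `F' = (T b T⁻¹) F` has
      -- degree at most `c - 1` in order `n`.
      have hle : ∀ k ≤ n, DegreeLE 0 (coeff k F) := by
        intro k hk j hj
        rw [ih k (by omega) j (by omega), degreeLE_one j hj, ite_self]
      have hs : DegreeLE (c - 1) (coeff n (termDeriv F)) := by
        rw [hdF, coeff_mul]
        refine DegreeLE.sum fun p hp => ?_
        have := mem_antidiagonal.1 hp
        exact ((hTbT' _).mul (hle p.2 (by omega))).mono (by omega)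
      rw [if_neg n.succ_ne_zero]
      refine nsmul_succ_cancel 𝕜 (n := n) ?_
      have h := (congrArg (fun x : OpSeries 𝕜 R => x.coeff i) (coeff_termDeriv F n)).symm.trans
        (hs i (by omega))
      exact h

/-- In the situation of `dressing_degreeLE`, for `c = 0`, or `c = 1` and `w₀ = 1`: the series
`∑ T(wᵢ) uⁱ` and `∑ σᶜ(vⱼ) uʲ` are inverse to each other. This is the coefficient of `Θᶜ` in
`T(W) (1 - u Θ⁻¹)⁻¹ V`. -/
theorem dressing_inverse (σ : R ≃ₐ[𝕜] R) (D : ℕ → Derivation 𝕜 R R)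
    (hσ : ∀ i a, D i (σ a) = σ (D i a))
    (hD : ∀ i j, Commute (D i : Module.End 𝕜 R) (D j : Module.End 𝕜 R))
    (c : ℕ) (w v : ℕ → R) (hc : c = 0 ∨ c = 1 ∧ w 0 = 1) (B : ℕ → OpSeries 𝕜 R)
    (hWV : opPower σ w * opPower σ (fun j => (σ ^ (j : ℤ)) (v j)) = 1)
    (hB : ∀ i, DegreeLE (c - 1) (B i))
    (hflow : ∀ i : ℕ, HahnSeries.C (D i : Module.End 𝕜 R) *
        HahnSeries.ofPowerSeries ℤ _ (opPower σ w) +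
        HahnSeries.ofPowerSeries ℤ _ (opPower σ w) * thetaPow σ (-((i + 1 : ℕ) : ℤ)) =
      B i * HahnSeries.ofPowerSeries ℤ _ (opPower σ w) +
        HahnSeries.ofPowerSeries ℤ _ (opPower σ w) * HahnSeries.C (D i : Module.End 𝕜 R)) :
    (PowerSeries.mk fun n => ∑ p ∈ antidiagonal n, coeff p.1 (shiftSeries D) (w p.2)) *
      (PowerSeries.mk fun j => (σ ^ (c : ℤ)) (v j)) = 1 := by
  have hv : ∀ n : ℕ, ∑ p ∈ antidiagonal n, ∑ q ∈ antidiagonal (p.2 + c),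
      coeff p.1 (shiftSeries D) (w q.1) * (σ ^ (c : ℤ)) (v q.2) =
        if n = 0 ∧ c = 0 then 1 else 0 := by
    intro n
    have h := dressing_degreeLE σ D hσ hD c (by omega) w
      (HahnSeries.ofPowerSeries ℤ _ (opPower σ (fun j => (σ ^ (j : ℤ)) (v j)))) B
      (by rw [← map_mul, hWV, map_one]) hB hflow n c le_rfl
    rw [HahnSeries.coeff_sum] at h
    have h' := congrArg (fun x : Module.End 𝕜 R => x 1) h
    simp only [LinearMap.sum_apply, coeff_opPower_mul_thetaPow_mul_apply_one] at h'
    rw [h']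
    by_cases hn : n = 0
    · by_cases hc0 : c = 0 <;> simp [hn, hc0, HahnSeries.coeff_one]
    · simp [hn]
  have hL : ∀ n, coeff n ((PowerSeries.mk fun n => ∑ p ∈ antidiagonal n,
        coeff p.1 (shiftSeries D) (w p.2)) * (PowerSeries.mk fun j => (σ ^ (c : ℤ)) (v j))) =
      ∑ p ∈ antidiagonal n, ∑ q ∈ antidiagonal p.2,
        coeff p.1 (shiftSeries D) (w q.1) * (σ ^ (c : ℤ)) (v q.2) := by
    intro n
    simp only [coeff_mul, coeff_mk, sum_mul]
    exact sum_antidiagonal_triple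
      (fun a b d => coeff a (shiftSeries D) (w b) * (σ ^ (c : ℤ)) (v d)) n
  ext1 n
  rw [hL]
  rcases hc with rfl | ⟨rfl, hw⟩
  · simpa [coeff_one] using hv n
  · cases n with
    | zero =>
      have := congrArg (fun x : (Module.End 𝕜 R)⟦X⟧ => (coeff 0 x : Module.End 𝕜 R) 1) hWV
      simp only [coeff_mul] at this
      simp [opPower, shiftOp_apply, hw] at this
      simp [constantCoeff_shiftSeries, hw, this]
    | succ n =>
      -- For `c = 1` the coefficient of `Θ` in order `n` misses one summand of the product in order
      -- `n + 1`: the one with `T(w₀)` in order `n + 1`, which is zero as `w₀ = 1`.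
      have h0 : coeff (n + 1) (shiftSeries D) (1 : R) = 0 := coeff_succ_shiftSeries_one D hD n
      rw [Nat.sum_antidiagonal_succ', hv n]
      simp [coeff_one, hw, h0]

/-- If `W = ∑ wᵢ Θⁱ` is given by a tau-function through `∑ wᵢ uⁱ = T⁻¹(ρ) / τ`, then its inverse
`∑ Θʲ vⱼ` is given by `∑ σᶜ(vⱼ) uʲ = T(τ) / ρ`: applying the multiplicative shift `T` to the former
gives `∑ T(wᵢ) uⁱ = ρ / T(τ)`, whose inverse is the latter by `dressing_inverse`. -/
theorem dressing_inverse_tau (σ : R ≃ₐ[𝕜] R) (D : ℕ → Derivation 𝕜 R R)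
    (hσ : ∀ i a, D i (σ a) = σ (D i a))
    (hD : ∀ i j, Commute (D i : Module.End 𝕜 R) (D j : Module.End 𝕜 R))
    (c : ℕ) (w v : ℕ → R) (hc : c = 0 ∨ c = 1 ∧ w 0 = 1) (B : ℕ → OpSeries 𝕜 R)
    (hWV : opPower σ w * opPower σ (fun j => (σ ^ (j : ℤ)) (v j)) = 1)
    (hB : ∀ i, DegreeLE (c - 1) (B i))
    (hflow : ∀ i : ℕ, HahnSeries.C (D i : Module.End 𝕜 R) *
        HahnSeries.ofPowerSeries ℤ _ (opPower σ w) +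
        HahnSeries.ofPowerSeries ℤ _ (opPower σ w) * thetaPow σ (-((i + 1 : ℕ) : ℤ)) =
      B i * HahnSeries.ofPowerSeries ℤ _ (opPower σ w) +
        HahnSeries.ofPowerSeries ℤ _ (opPower σ w) * HahnSeries.C (D i : Module.End 𝕜 R))
    (τ ρ : R) (hw : ∀ i, w i * τ = coeff i (shiftSeries fun i => -D i) ρ) (n : ℕ) :
    (σ ^ (c : ℤ)) (v n) * ρ = coeff n (shiftSeries D) τ := by
  have h := dressing_inverse σ D hσ hD c w v hc B hWV hB hflow
  set P : R⟦X⟧ := PowerSeries.mk fun n => ∑ p ∈ antidiagonal n, coeff p.1 (shiftSeries D) (w p.2)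
  set Q : R⟦X⟧ := PowerSeries.mk fun j => (σ ^ (c : ℤ)) (v j)
  have hP : P * (PowerSeries.mk fun n => coeff n (shiftSeries D) τ) = C ρ := by
    ext1 n
    have h1 : ∀ (a b : R) (n : ℕ), coeff n (shiftSeries D) (a * b) =
        ∑ p ∈ antidiagonal n, coeff p.1 (shiftSeries D) a * coeff p.2 (shiftSeries D) b := by
      intro a b n
      have := congrArg (fun x : (Module.End 𝕜 R)⟦X⟧ => (coeff n x : Module.End 𝕜 R) b)
        (shiftSeries_mul_C D a)
      rw [coeff_mul_C, coeff_mul] at this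
      simpa only [LinearMap.sum_apply, shiftMul, coeff_mk, Module.End.mul_apply, mulOp_apply]
        using this
    have h2 := congrArg (fun x : (Module.End 𝕜 R)⟦X⟧ => (coeff n x : Module.End 𝕜 R) ρ)
        (shiftSeries_mul_neg D hD)
    simp only [coeff_mul, LinearMap.sum_apply, Module.End.mul_apply, ← hw, h1] at h2
    rw [sum_antidiagonal_triple (fun a b d => coeff a (shiftSeries D) (w d) *
      coeff b (shiftSeries D) τ)] at h2
    simp only [P, coeff_mul, coeff_mk, sum_mul]
    rw [sum_antidiagonal_triple (fun a b d => coeff a (shiftSeries D) (w b) *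
      coeff d (shiftSeries D) τ), coeff_C]
    rw [coeff_one] at h2
    calc _ = _ := sum_congr rfl fun p _ => (Nat.sum_antidiagonal_swap ..).symm
      _ = _ := h2
      _ = _ := by split_ifs <;> rfl
  have hQ : Q * C ρ = PowerSeries.mk fun n => coeff n (shiftSeries D) τ := by
    rw [← hP, ← mul_assoc, mul_comm Q, h, one_mul]
  simpa [Q] using congrArg (coeff n) hQ

end Dressing
end EBTH

namespace EBTH
open Finset

/-! ### Smooth functions of infinitely many variables -/

section Smooth
variable {𝕜 : Type*} [RCLike 𝕜] {k m : ℕ+} {Ω : Domain 𝕜 k m}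

theorem Fn.ext_of_mem (f : Fn Ω) {q : Point 𝕜 k m} (hq : q ∈ Ω.carrier) : f.ext q = f ⟨q, hq⟩ :=
  Subtype.val_injective.extend_apply f 0 (⟨q, hq⟩ : Ω.carrier)

theorem Fn.ext_of_notMem (f : Fn Ω) {q : Point 𝕜 k m} (hq : q ∉ Ω.carrier) : f.ext q = 0 :=
  Function.extend_apply' _ _ _ fun ⟨a, ha⟩ => hq (ha ▸ a.2)

/-- The displacement in the variables of `F` by the amounts `y`. -/
def displace (F : Finset (TodaVar k m)) : (F → 𝕜) →ₗ[𝕜] Point 𝕜 k m where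
  toFun y := ∑ v : F, y v • unitVec 𝕜 v.1
  map_add' y z := by simp [add_smul, sum_add_distrib]
  map_smul' a y := by simp [mul_smul, smul_sum]

theorem displace_apply (F : Finset (TodaVar k m)) (y : F → 𝕜) :
    displace F y = ∑ v : F, y v • unitVec 𝕜 v.1 := rfl

open Classical in
/-- The coordinate vector of the variable `v` in `F → 𝕜`, zero if `v ∉ F`. -/
def coordVec (F : Finset (TodaVar k m)) (v : TodaVar k m) : F → 𝕜 :=
  fun w => if w.1 = v then 1 else 0

theorem displace_coordVec {F : Finset (TodaVar k m)} {v : TodaVar k m} (hv : v ∈ F) :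
    displace F (coordVec F v) = unitVec 𝕜 v := by
  rw [displace_apply, sum_eq_single ⟨v, hv⟩]
  · simp [coordVec]
  · intro w _ hw
    have : w.1 ≠ v := fun h => hw (Subtype.ext h)
    simp [coordVec, this]
  · simp

theorem displace_sum {ι : Type*} {F : Finset (TodaVar k m)} {s : Finset ι} {v : ι → TodaVar k m}
    (hv : ∀ i ∈ s, v i ∈ F) (c : ι → 𝕜) :
    displace F (∑ i ∈ s, c i • coordVec F (v i)) = ∑ i ∈ s, c i • unitVec 𝕜 (v i) := by
  rw [map_sum]
  exact sum_congr rfl fun i hi => by rw [map_smul, displace_coordVec (hv i hi)]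

/-- The restriction of `f` to the slice through `p` in the variables of `F`. -/
def Fn.slice (f : Fn Ω) (p : Point 𝕜 k m) (F : Finset (TodaVar k m)) : (F → 𝕜) → 𝕜 :=
  fun y => f.ext (p + displace F y)

theorem Domain.eventually_displace_mem {p : Point 𝕜 k m} {F : Finset (TodaVar k m)} {y : F → 𝕜}
    (hy : p + displace F y ∈ Ω.carrier) : ∀ᶠ z in nhds y, p + displace F z ∈ Ω.carrier :=
  (Ω.isOpen_slice p F).mem_nhds hy

theorem Fn.Smooth.contDiffAt_slice {f : Fn Ω} (hf : f.Smooth) {p : Point 𝕜 k m}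
    {F : Finset (TodaVar k m)} {y : F → 𝕜} (hy : p + displace F y ∈ Ω.carrier) :
    ContDiffAt 𝕜 ∞ (f.slice p F) y :=
  (hf p F).contDiffAt ((Ω.isOpen_slice p F).mem_nhds hy)

theorem Fn.smooth_of_contDiffAt {f : Fn Ω}
    (h : ∀ (p : Point 𝕜 k m) (F : Finset (TodaVar k m)) (y : F → 𝕜),
      p + displace F y ∈ Ω.carrier → ContDiffAt 𝕜 ∞ (f.slice p F) y) : f.Smooth :=
  fun p F y hy => (h p F y hy).contDiffWithinAt

/-- A smooth function stays smooth when finitely many of the variables, possibly with repetitions,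
are displaced by smooth amounts `cᵢ`. -/
theorem Fn.Smooth.contDiffAt_comp {E : Type*} [NormedAddCommGroup E] [NormedSpace 𝕜 E] {f : Fn Ω}
    (hf : f.Smooth) {ι : Type*} {s : Finset ι} {v : ι → TodaVar k m} {c : ι → E → 𝕜}
    {p : Point 𝕜 k m} {x : E} (hc : ∀ i ∈ s, ContDiffAt 𝕜 ∞ (c i) x)
    (hx : p + ∑ i ∈ s, c i x • unitVec 𝕜 (v i) ∈ Ω.carrier) :
    ContDiffAt 𝕜 ∞ (fun y => f.ext (p + ∑ i ∈ s, c i y • unitVec 𝕜 (v i))) x := by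
  classical
  have hv : ∀ i ∈ s, v i ∈ s.image v := fun i hi => mem_image_of_mem v hi
  have h : (fun y => f.ext (p + ∑ i ∈ s, c i y • unitVec 𝕜 (v i))) =
      f.slice p (s.image v) ∘ fun y => ∑ i ∈ s, c i y • coordVec (s.image v) (v i) := by
    funext y
    simp only [Function.comp, Fn.slice, displace_sum hv]
  rw [h]
  refine ContDiffAt.comp x (hf.contDiffAt_slice ?_)
    (ContDiffAt.sum fun i hi => (hc i hi).smul contDiffAt_const)
  rwa [displace_sum hv]

theorem Domain.eventually_mem {E : Type*} [TopologicalSpace E] {ι : Type*} {s : Finset ι}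
    {v : ι → TodaVar k m} {c : ι → E → 𝕜} {p : Point 𝕜 k m} {x : E}
    (hc : ∀ i ∈ s, ContinuousAt (c i) x)
    (hx : p + ∑ i ∈ s, c i x • unitVec 𝕜 (v i) ∈ Ω.carrier) :
    ∀ᶠ y in nhds x, p + ∑ i ∈ s, c i y • unitVec 𝕜 (v i) ∈ Ω.carrier := by
  classical
  have hv : ∀ i ∈ s, v i ∈ s.image v := fun i hi => mem_image_of_mem v hi
  simp only [← displace_sum hv] at hx ⊢
  have hcont : ContinuousAt (fun y => ∑ i ∈ s, c i y • coordVec (𝕜 := 𝕜) (s.image v) (v i)) x :=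
    tendsto_finsetSum _ fun i hi => (hc i hi).smul continuousAt_const
  exact hcont.eventually (Domain.eventually_displace_mem hx)

/-- On a slice, the partial derivatives are the values of the Fréchet derivative on coordinate
vectors. -/
theorem Fn.Smooth.pd_ext {f : Fn Ω} (hf : f.Smooth) {p : Point 𝕜 k m}
    {F : Finset (TodaVar k m)} {y : F → 𝕜} (hy : p + displace F y ∈ Ω.carrier) {v : TodaVar k m}
    (hv : v ∈ F) :
    (Fn.pd v f).ext (p + displace F y) = fderiv 𝕜 (f.slice p F) y (coordVec F v) := by
  rw [Fn.ext_of_mem _ hy, Fn.pd]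
  have hl : HasDerivAt (fun u : 𝕜 => y + u • coordVec F v) (coordVec F v) 0 := by
    simpa using ((hasDerivAt_id (0 : 𝕜)).smul_const (coordVec F v)).const_add y
  have hd : HasFDerivAt (f.slice p F) (fderiv 𝕜 (f.slice p F) y)
      ((fun u : 𝕜 => y + u • coordVec F v) 0) := by
    simpa using ((hf.contDiffAt_slice hy).differentiableAt (by simp)).hasFDerivAt
  have := hd.comp_hasDerivAt (0 : 𝕜) hl
  rw [← this.deriv]
  congr 1
  funext u
  simp only [Function.comp, Fn.slice, map_add, map_smul, displace_coordVec hv, add_assoc]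

/-- The chain rule along a curve that moves finitely many variables. -/
theorem Fn.Smooth.hasDerivAt_comp {f : Fn Ω}
    (hf : f.Smooth) {ι : Type*} {s : Finset ι} {v : ι → TodaVar k m} {c : ι → 𝕜 → 𝕜} {c' : ι → 𝕜}
    {p : Point 𝕜 k m} {x : 𝕜} (hc : ∀ i ∈ s, HasDerivAt (c i) (c' i) x)
    (hx : p + ∑ i ∈ s, c i x • unitVec 𝕜 (v i) ∈ Ω.carrier) :
    HasDerivAt (fun y => f.ext (p + ∑ i ∈ s, c i y • unitVec 𝕜 (v i)))
      (∑ i ∈ s, c' i * (Fn.pd (v i) f).ext (p + ∑ i ∈ s, c i x • unitVec 𝕜 (v i))) x := by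
  classical
  have hv : ∀ i ∈ s, v i ∈ s.image v := fun i hi => mem_image_of_mem v hi
  simp only [← displace_sum hv] at hx ⊢
  have hl : HasDerivAt (fun y => ∑ i ∈ s, c i y • coordVec (𝕜 := 𝕜) (s.image v) (v i))
      (∑ i ∈ s, c' i • coordVec (s.image v) (v i)) x :=
    HasDerivAt.fun_sum fun i hi => (hc i hi).smul_const _
  have hd := ((hf.contDiffAt_slice hx).differentiableAt (by simp)).hasFDerivAt
  have := hd.comp_hasDerivAt x hl
  rw [map_sum] at this
  refine this.congr_deriv (sum_congr rfl fun i hi => ?_)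
  rw [map_smul, hf.pd_ext hx (hv i hi), smul_eq_mul]

theorem Fn.Smooth.hasDerivAt_pd {f : Fn Ω} (hf : f.Smooth) (v : TodaVar k m) (p : Ω.carrier) :
    HasDerivAt (fun u : 𝕜 => f.ext (p.1 + u • unitVec 𝕜 v)) (Fn.pd v f p) 0 := by
  have := hf.hasDerivAt_comp (s := {()}) (v := fun _ => v) (c := fun _ u => u) (c' := fun _ => 1)
    (p := p.1) (x := 0) (fun _ _ => hasDerivAt_id _) (by simp)
  simpa [Fn.ext_of_mem _ p.2] using this

theorem Fn.Smooth.pd {f : Fn Ω} (hf : f.Smooth) (v : TodaVar k m) : (Fn.pd v f).Smooth := by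
  classical
  refine Fn.smooth_of_contDiffAt fun p F y hy => ?_
  have hF : ∀ w ∈ (univ : Finset F), w.1 ∈ insert v F := fun w _ => mem_insert_of_mem w.2
  set ι : (F → 𝕜) → {x // x ∈ insert v F} → 𝕜 :=
    fun z => ∑ w : F, z w • coordVec (𝕜 := 𝕜) _ w.1 with hι
  have hd : ∀ z, displace F z = displace _ (ι z) := fun z => by
    rw [hι, displace_sum hF, displace_apply]
  have hsm : ContDiff 𝕜 ∞ ι :=
    ContDiff.sum fun w _ => (contDiff_apply 𝕜 𝕜 w).smul contDiff_const
  have hev : (Fn.pd v f).slice p F =ᶠ[nhds y]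
      fun z => fderiv 𝕜 (f.slice p (insert v F)) (ι z) (coordVec _ v) := by
    filter_upwards [Domain.eventually_displace_mem hy] with z hz
    rw [Fn.slice, hd, hf.pd_ext (by rwa [← hd]) (mem_insert_self v F)]
  refine ContDiffAt.congr_of_eventuallyEq ?_ hev
  rw [hd] at hy
  have h1 : ContDiffAt 𝕜 ∞ (fderiv 𝕜 (f.slice p (insert v F))) (ι y) :=
    (hf.contDiffAt_slice hy).fderiv_right (by simp)
  exact (h1.comp y hsm.contDiffAt).clm_apply contDiffAt_const

theorem Fn.Smooth.pd_comm {f : Fn Ω} (hf : f.Smooth) (v w : TodaVar k m) :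
    Fn.pd v (Fn.pd w f) = Fn.pd w (Fn.pd v f) := by
  classical
  funext p
  set F : Finset (TodaVar k m) := {v, w} with hF
  have hv : v ∈ F := by simp [hF]
  have hw : w ∈ F := by simp [hF]
  have hp : p.1 + displace F 0 ∈ Ω.carrier := by simp
  have key : ∀ a b : TodaVar k m, a ∈ F → b ∈ F → Fn.pd a (Fn.pd b f) p =
      fderiv 𝕜 (fderiv 𝕜 (f.slice p.1 F)) 0 (coordVec F a) (coordVec F b) := by
    intro a b ha hb
    have h0 : Fn.pd a (Fn.pd b f) p = (Fn.pd a (Fn.pd b f)).ext (p.1 + displace F 0) := by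
      rw [map_zero, add_zero, Fn.ext_of_mem _ p.2]
    have hev : (Fn.pd b f).slice p.1 F =ᶠ[nhds 0]
        fun z => fderiv 𝕜 (f.slice p.1 F) z (coordVec F b) := by
      filter_upwards [Domain.eventually_displace_mem hp] with z hz
      exact hf.pd_ext hz hb
    have hdiff : DifferentiableAt 𝕜 (fderiv 𝕜 (f.slice p.1 F)) 0 :=
      ((hf.contDiffAt_slice hp).fderiv_right (m := ∞) (by simp)).differentiableAt (by simp)
    rw [h0, (hf.pd b).pd_ext hp ha, hev.fderiv_eq,
      (hdiff.hasFDerivAt.clm_apply (hasFDerivAt_const (coordVec F b) 0)).fderiv]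
    simp
  rw [key v w hv hw, key w v hw hv]
  have : IsSymmSndFDerivAt 𝕜 (f.slice p.1 F) 0 :=
    (hf.contDiffAt_slice hp).isSymmSndFDerivAt (by
      rw [minSmoothness_of_isRCLikeNormedField]
      exact show ((2 : ℕ∞) : WithTop ℕ∞) ≤ ∞ from WithTop.coe_le_coe.2 le_top)
  exact this.eq _ _

theorem Domain.add_mem_iff (Ω : Domain 𝕜 k m) (j : ℤ) (q : Point 𝕜 k m) :
    q + (j : 𝕜) • unitVec 𝕜 TodaVar.s ∈ Ω.carrier ↔ q ∈ Ω.carrier := by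
  refine ⟨fun h => ?_, fun h => Ω.shift_mem q h j⟩
  have := Ω.shift_mem _ h (-j)
  rwa [Int.cast_neg, neg_smul, add_neg_cancel_right] at this

theorem Fn.ext_shift (f : Fn Ω) (j : ℤ) (q : Point 𝕜 k m) :
    (Fn.shift j f).ext q = f.ext (q + (j : 𝕜) • unitVec 𝕜 TodaVar.s) := by
  by_cases h : q ∈ Ω.carrier
  · rw [Fn.ext_of_mem _ h, Fn.ext_of_mem _ (Ω.shift_mem q h j)]
    rfl
  · rw [Fn.ext_of_notMem _ h, Fn.ext_of_notMem _ (by rwa [Ω.add_mem_iff])]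

theorem Fn.Smooth.shift {f : Fn Ω} (hf : f.Smooth) (j : ℤ) : (Fn.shift j f).Smooth := by
  refine Fn.smooth_of_contDiffAt fun p F y hy => ?_
  have h : (Fn.shift j f).slice p F = f.slice (p + (j : 𝕜) • unitVec 𝕜 TodaVar.s) F := by
    funext z
    rw [Fn.slice, Fn.slice, Fn.ext_shift, add_right_comm]
  rw [h]
  refine hf.contDiffAt_slice ?_
  rwa [add_right_comm, Ω.add_mem_iff]

theorem Fn.pd_shift (f : Fn Ω) (v : TodaVar k m) (j : ℤ) :
    Fn.pd v (Fn.shift j f) = Fn.shift j (Fn.pd v f) := by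
  funext p
  simp only [Fn.pd, Fn.shift, Fn.ext_shift, Domain.shift]
  congr 1
  funext u
  rw [add_right_comm]

theorem Domain.shift_shift (Ω : Domain 𝕜 k m) (i j : ℤ) (p : Ω.carrier) :
    Ω.shift j (Ω.shift i p) = Ω.shift (i + j) p := by
  apply Subtype.ext
  simp [Domain.shift, add_smul, add_assoc]

theorem Domain.shift_zero (Ω : Domain 𝕜 k m) (p : Ω.carrier) : Ω.shift 0 p = p := by
  apply Subtype.ext
  simp [Domain.shift]

theorem Fn.shift_shift (i j : ℤ) (f : Fn Ω) : Fn.shift i (Fn.shift j f) = Fn.shift (i + j) f := by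
  funext p
  simp only [Fn.shift, Ω.shift_shift]

theorem Fn.shift_zero (f : Fn Ω) : Fn.shift 0 f = f := by
  funext p
  rw [Fn.shift, Ω.shift_zero]

theorem Fn.smooth_const (a : 𝕜) : Fn.Smooth (fun _ : Ω.carrier => a) := by
  refine Fn.smooth_of_contDiffAt fun p F y hy => ?_
  refine (contDiffAt_const (c := a)).congr_of_eventuallyEq ?_
  filter_upwards [Domain.eventually_displace_mem hy] with z hz
  rw [Fn.slice, Fn.ext_of_mem _ hz]

theorem Fn.Smooth.add {f g : Fn Ω} (hf : f.Smooth) (hg : g.Smooth) : Fn.Smooth (f + g) := by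
  refine Fn.smooth_of_contDiffAt fun p F y hy => ?_
  refine ((hf.contDiffAt_slice hy).add (hg.contDiffAt_slice hy)).congr_of_eventuallyEq ?_
  filter_upwards [Domain.eventually_displace_mem hy] with z hz
  simp [Fn.slice, Fn.ext_of_mem _ hz]

theorem Fn.Smooth.mul {f g : Fn Ω} (hf : f.Smooth) (hg : g.Smooth) : Fn.Smooth (f * g) := by
  refine Fn.smooth_of_contDiffAt fun p F y hy => ?_
  refine ((hf.contDiffAt_slice hy).mul (hg.contDiffAt_slice hy)).congr_of_eventuallyEq ?_
  filter_upwards [Domain.eventually_displace_mem hy] with z hz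
  simp [Fn.slice, Fn.ext_of_mem _ hz]

theorem Fn.Smooth.inv {f : Fn Ω} (hf : f.Smooth) (h0 : ∀ p, f p ≠ 0) : Fn.Smooth f⁻¹ := by
  refine Fn.smooth_of_contDiffAt fun p F y hy => ?_
  refine ((hf.contDiffAt_slice hy).inv ?_).congr_of_eventuallyEq ?_
  · rw [Fn.slice, Fn.ext_of_mem _ hy]
    exact h0 _
  filter_upwards [Domain.eventually_displace_mem hy] with z hz
  simp [Fn.slice, Fn.ext_of_mem _ hz]

/-- The algebra of smooth functions. -/
def smoothAlg (Ω : Domain 𝕜 k m) : Subalgebra 𝕜 (Fn Ω) where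
  carrier := {f | f.Smooth}
  mul_mem' := Fn.Smooth.mul
  add_mem' := Fn.Smooth.add
  algebraMap_mem' a := Fn.smooth_const a

theorem Fn.Smooth.pd_add {f g : Fn Ω} (hf : f.Smooth) (hg : g.Smooth) (v : TodaVar k m) :
    Fn.pd v (f + g) = Fn.pd v f + Fn.pd v g := by
  funext p
  refine HasDerivAt.unique ((hf.add hg).hasDerivAt_pd v p) ?_
  refine ((hf.hasDerivAt_pd v p).add (hg.hasDerivAt_pd v p)).congr_of_eventuallyEq ?_
  refine Filter.Eventually.of_forall fun u => ?_
  by_cases h : p.1 + u • unitVec 𝕜 v ∈ Ω.carrier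
  · simp [Fn.ext_of_mem _ h]
  · simp [Fn.ext_of_notMem _ h]

theorem Fn.Smooth.pd_mul {f g : Fn Ω} (hf : f.Smooth) (hg : g.Smooth) (v : TodaVar k m) :
    Fn.pd v (f * g) = f * Fn.pd v g + g * Fn.pd v f := by
  funext p
  refine HasDerivAt.unique ((hf.mul hg).hasDerivAt_pd v p) ?_
  have h := (hf.hasDerivAt_pd v p).mul (hg.hasDerivAt_pd v p)
  have h2 : (f * Fn.pd v g + g * Fn.pd v f) p = Fn.pd v f p * g.ext (p.1 + (0 : 𝕜) • unitVec 𝕜 v) +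
      f.ext (p.1 + (0 : 𝕜) • unitVec 𝕜 v) * Fn.pd v g p := by
    rw [zero_smul, add_zero, Fn.ext_of_mem _ p.2, Fn.ext_of_mem _ p.2]
    simp only [Pi.add_apply, Pi.mul_apply]
    ring
  rw [h2]
  refine h.congr_of_eventuallyEq ?_
  refine Filter.Eventually.of_forall fun u => ?_
  by_cases h : p.1 + u • unitVec 𝕜 v ∈ Ω.carrier
  · simp [Fn.ext_of_mem _ h]
  · simp [Fn.ext_of_notMem _ h]

theorem Fn.pd_smul (f : Fn Ω) (a : 𝕜) (v : TodaVar k m) :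
    Fn.pd v (a • f) = a • Fn.pd v f := by
  funext p
  simp only [Fn.pd, Pi.smul_apply, smul_eq_mul]
  rw [← deriv_const_mul_field]
  congr 1
  funext u
  by_cases h : p.1 + u • unitVec 𝕜 v ∈ Ω.carrier
  · simp [Fn.ext_of_mem _ h]
  · simp [Fn.ext_of_notMem _ h]

/-- The partial derivative as a derivation of the algebra of smooth functions. -/
def pdDeriv (Ω : Domain 𝕜 k m) (v : TodaVar k m) : Derivation 𝕜 (smoothAlg Ω) (smoothAlg Ω) :=
  Derivation.mk'
    { toFun := fun f => ⟨Fn.pd v f.1, Fn.Smooth.pd f.2 v⟩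
      map_add' := fun f g => Subtype.ext (Fn.Smooth.pd_add f.2 g.2 v)
      map_smul' := fun a f => Subtype.ext (Fn.pd_smul f.1 a v) }
    fun f g => Subtype.ext (Fn.Smooth.pd_mul f.2 g.2 v)

theorem coe_pdDeriv (v : TodaVar k m) (f : smoothAlg Ω) : (pdDeriv Ω v f).1 = Fn.pd v f.1 := rfl

theorem commute_pdDeriv (v w : TodaVar k m) :
    Commute (pdDeriv Ω v : Module.End 𝕜 (smoothAlg Ω)) (pdDeriv Ω w) :=
  LinearMap.ext fun f => Subtype.ext (Fn.Smooth.pd_comm f.2 v w)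

/-- The derivations `ε ∂/∂vᵢ`. -/
def scaledDeriv (Ω : Domain 𝕜 k m) (ε : 𝕜) (v : ℕ → TodaVar k m) (i : ℕ) :
    Derivation 𝕜 (smoothAlg Ω) (smoothAlg Ω) := ε • pdDeriv Ω (v i)

theorem coe_scaledDeriv (ε : 𝕜) (v : ℕ → TodaVar k m) (i : ℕ) (f : smoothAlg Ω) :
    (scaledDeriv Ω ε v i f).1 = ε • Fn.pd (v i) f.1 := rfl

theorem neg_scaledDeriv (ε : 𝕜) (v : ℕ → TodaVar k m) (i : ℕ) :
    -scaledDeriv Ω ε v i = scaledDeriv Ω (-ε) v i :=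
  Derivation.ext fun f => Subtype.ext (by
    rw [coe_scaledDeriv, neg_smul]
    rfl)

theorem commute_scaledDeriv (ε : 𝕜) (v : ℕ → TodaVar k m) (i j : ℕ) :
    Commute (scaledDeriv Ω ε v i : Module.End 𝕜 (smoothAlg Ω)) (scaledDeriv Ω ε v j) :=
  ((commute_pdDeriv (v i) (v j)).smul_left ε).smul_right ε

/-- The shift `s ↦ s + j` as an algebra endomorphism of the smooth functions. -/
def shiftHom (Ω : Domain 𝕜 k m) (j : ℤ) : smoothAlg Ω →ₐ[𝕜] smoothAlg Ω where
  toFun f := ⟨Fn.shift j f.1, Fn.Smooth.shift f.2 j⟩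
  map_one' := rfl
  map_mul' _ _ := rfl
  map_zero' := rfl
  map_add' _ _ := rfl
  commutes' _ := rfl

/-- The shift `s ↦ s + j` as an automorphism of the algebra of smooth functions. -/
def shiftEquiv (Ω : Domain 𝕜 k m) (j : ℤ) : smoothAlg Ω ≃ₐ[𝕜] smoothAlg Ω :=
  AlgEquiv.ofAlgHom (shiftHom Ω j) (shiftHom Ω (-j))
    (AlgHom.ext fun f => Subtype.ext (by
      change Fn.shift j (Fn.shift (-j) f.1) = f.1
      rw [Fn.shift_shift, add_neg_cancel, Fn.shift_zero]))
    (AlgHom.ext fun f => Subtype.ext (by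
      change Fn.shift (-j) (Fn.shift j f.1) = f.1
      rw [Fn.shift_shift, neg_add_cancel, Fn.shift_zero]))

theorem coe_shiftEquiv (j : ℤ) (f : smoothAlg Ω) : (shiftEquiv Ω j f).1 = Fn.shift j f.1 := rfl

theorem scaledDeriv_shiftEquiv (ε : 𝕜) (v : ℕ → TodaVar k m) (e : ℤ) (i : ℕ) (f : smoothAlg Ω) :
    scaledDeriv Ω ε v i (shiftEquiv Ω e f) = shiftEquiv Ω e (scaledDeriv Ω ε v i f) :=
  Subtype.ext (by
    rw [coe_scaledDeriv, coe_shiftEquiv, coe_shiftEquiv, coe_scaledDeriv, Fn.pd_shift]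
    rfl)

theorem coe_shiftEquiv_zpow (e i : ℤ) (f : smoothAlg Ω) :
    ((shiftEquiv Ω e ^ i) f).1 = Fn.shift (e * i) f.1 := by
  have h : ∀ i, shiftEquiv Ω e ^ i = shiftEquiv Ω (e * i) := by
    have hadd : ∀ a b, shiftEquiv Ω (a + b) = shiftEquiv Ω a * shiftEquiv Ω b := fun a b =>
      AlgEquiv.ext fun f => Subtype.ext (Fn.shift_shift a b f.1).symm
    have h0 : shiftEquiv Ω 0 = 1 := AlgEquiv.ext fun f => Subtype.ext (Fn.shift_zero f.1)
    let φ : Multiplicative ℤ →* (smoothAlg Ω ≃ₐ[𝕜] smoothAlg Ω) :=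
      { toFun := fun j => shiftEquiv Ω j.toAdd, map_one' := h0, map_mul' := fun a b => hadd _ _ }
    intro i
    have := (map_zpow φ (Multiplicative.ofAdd e) i).symm
    rw [← ofAdd_zsmul, zsmul_eq_mul, mul_comm] at this
    exact this
  rw [h, coe_shiftEquiv]

/-! ### Taylor coefficients of shifted functions -/

theorem iteratedDeriv_pow_mul_zero {g : 𝕜 → 𝕜} (hg : ContDiffAt 𝕜 ∞ g 0) (n i : ℕ) :
    iteratedDeriv n (fun u => u ^ i * g u) 0 / (n.factorial : 𝕜) =
      if i ≤ n then iteratedDeriv (n - i) g 0 / ((n - i).factorial : 𝕜) else 0 := by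
  rw [iteratedDeriv_fun_mul (by fun_prop) (hg.of_le (by exact_mod_cast le_top))]
  simp only [iteratedDeriv_fun_pow_zero]
  split_ifs with h
  · rw [sum_eq_single i]
    · rw [if_pos rfl, Nat.cast_choose 𝕜 h]
      have h1 : (n.factorial : 𝕜) ≠ 0 := Nat.cast_ne_zero.2 n.factorial_ne_zero
      have h2 : (i.factorial : 𝕜) ≠ 0 := Nat.cast_ne_zero.2 i.factorial_ne_zero
      have h3 : ((n - i).factorial : 𝕜) ≠ 0 := Nat.cast_ne_zero.2 (n - i).factorial_ne_zero
      field_simp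
    · intro j _ hj
      simp [hj]
    · intro hi
      exact absurd (mem_range.2 (by omega)) hi
  · rw [sum_eq_zero, zero_div]
    intro j hj
    have : j ≠ i := by
      have := mem_range.1 hj
      omega
    simp [this]

/-- The Taylor coefficients along the curve `vᵢ ↦ vᵢ + ε uⁱ⁺¹ / (i + 1)`, `i < N`, are those of the
formal shift, as long as their order is at most `N`. The curve has the derivative `∑ ε uⁱ ∂/∂vᵢ`, so
both satisfy the recursion `(n + 1) fₙ₊₁ = ∑ ε (∂f/∂vᵢ)ₙ₋ᵢ`. -/
theorem iteratedDeriv_curve (ε : 𝕜) (v : ℕ → TodaVar k m) (n N : ℕ) (hn : n ≤ N)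
    (f : smoothAlg Ω) (p : Ω.carrier) :
    iteratedDeriv n (fun u : 𝕜 => f.1.ext (p.1 +
        ∑ i ∈ range N, (ε * u ^ (i + 1) / ((i + 1 : ℕ) : 𝕜)) • unitVec 𝕜 (v i))) 0 /
      (n.factorial : 𝕜) =
    (PowerSeries.coeff n (shiftSeries (scaledDeriv Ω ε v)) f).1 p := by
  have h0 : p.1 + ∑ i ∈ range N, (ε * (0 : 𝕜) ^ (i + 1) / ((i + 1 : ℕ) : 𝕜)) • unitVec 𝕜 (v i) =
      p.1 := by simp
  have hmem : p.1 + ∑ i ∈ range N, (ε * (0 : 𝕜) ^ (i + 1) / ((i + 1 : ℕ) : 𝕜)) • unitVec 𝕜 (v i) ∈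
      Ω.carrier := by
    rw [h0]
    exact p.2
  induction n using Nat.strong_induction_on generalizing f with
  | _ n ih =>
    cases n with
    | zero =>
      rw [iteratedDeriv_zero, h0, Fn.ext_of_mem _ p.2,
        PowerSeries.coeff_zero_eq_constantCoeff_apply, constantCoeff_shiftSeries]
      simp
    | succ n =>
      have hsm : ∀ g : smoothAlg Ω, ContDiffAt 𝕜 ∞ (fun u : 𝕜 => g.1.ext (p.1 +
          ∑ i ∈ range N, (ε * u ^ (i + 1) / ((i + 1 : ℕ) : 𝕜)) • unitVec 𝕜 (v i))) 0 := fun g =>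
        Fn.Smooth.contDiffAt_comp g.2
          (c := fun i u => ε * u ^ (i + 1) / ((i + 1 : ℕ) : 𝕜)) (fun i _ => by fun_prop) hmem
      have hder : deriv (fun u : 𝕜 => f.1.ext (p.1 +
          ∑ i ∈ range N, (ε * u ^ (i + 1) / ((i + 1 : ℕ) : 𝕜)) • unitVec 𝕜 (v i))) =ᶠ[nhds 0]
          fun u => ∑ i ∈ range N, ε * (u ^ i * (pdDeriv Ω (v i) f).1.ext (p.1 +
            ∑ i ∈ range N, (ε * u ^ (i + 1) / ((i + 1 : ℕ) : 𝕜)) • unitVec 𝕜 (v i))) := by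
        have hev := Domain.eventually_mem (Ω := Ω) (s := range N) (v := v) (p := p.1) (x := (0 : 𝕜))
          (c := fun i u => ε * u ^ (i + 1) / ((i + 1 : ℕ) : 𝕜)) (fun i _ => by fun_prop) hmem
        filter_upwards [hev] with u hu
        have := Fn.Smooth.hasDerivAt_comp f.2 (s := range N) (v := v) (p := p.1) (x := u)
          (c := fun i u => ε * u ^ (i + 1) / ((i + 1 : ℕ) : 𝕜)) (c' := fun i => ε * u ^ i)
          (fun i _ => by
            have h1 : ((i + 1 : ℕ) : 𝕜) ≠ 0 := Nat.cast_ne_zero.2 i.succ_ne_zero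
            refine (((hasDerivAt_pow (i + 1) u).const_mul ε).div_const _).congr_deriv ?_
            rw [Nat.add_sub_cancel]
            field_simp) hu
        rw [this.deriv]
        refine sum_congr rfl fun i _ => ?_
        rw [mul_assoc, coe_pdDeriv]
      have hT := congrArg (fun g : smoothAlg Ω => g.1 p)
        (nsmul_coeff_shiftSeries_apply (scaledDeriv Ω ε v) n f)
      have hT' : ((n + 1 : ℕ) : 𝕜) *
          (PowerSeries.coeff (n + 1) (shiftSeries (scaledDeriv Ω ε v)) f).1 p =
          ∑ i ∈ range (n + 1), ε *
            (PowerSeries.coeff (n - i) (shiftSeries (scaledDeriv Ω ε v))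
              (pdDeriv Ω (v i) f)).1 p := by
        rw [← nsmul_eq_mul]
        refine hT.trans ?_
        have hc : ∀ i j, scaledDeriv Ω ε v i
            (PowerSeries.coeff j (shiftSeries (scaledDeriv Ω ε v)) f) =
            ε • PowerSeries.coeff j (shiftSeries (scaledDeriv Ω ε v)) (pdDeriv Ω (v i) f) := by
          intro i j
          rw [← map_smul]
          exact LinearMap.congr_fun
            (commute_coeff_shiftSeries (commute_scaledDeriv (Ω := Ω) ε v i) j).eq f
        simp only [hc]
        rw [Nat.sum_antidiagonal_eq_sum_range_succ (fun i j =>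
          ε • PowerSeries.coeff j (shiftSeries (scaledDeriv Ω ε v)) (pdDeriv Ω (v i) f))]
        rw [AddSubmonoidClass.coe_finsetSum, Finset.sum_apply]
        rfl
      have hfac : ((n + 1).factorial : 𝕜) = ((n + 1 : ℕ) : 𝕜) * (n.factorial : 𝕜) := by
        rw [Nat.factorial_succ, Nat.cast_mul]
      have hn1 : ((n + 1 : ℕ) : 𝕜) ≠ 0 := Nat.cast_ne_zero.2 n.succ_ne_zero
      rw [iteratedDeriv_succ', hder.iteratedDeriv_eq, hfac, mul_comm, ← div_div, div_eq_iff hn1,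
        mul_comm _ ((n + 1 : ℕ) : 𝕜), hT', iteratedDeriv_fun_sum, sum_div]
      · rw [← sum_subset (range_mono hn)]
        · refine sum_congr rfl fun i hi => ?_
          have hi' : i ≤ n := Nat.lt_succ_iff.1 (mem_range.1 hi)
          rw [iteratedDeriv_const_mul_field, mul_div_assoc, iteratedDeriv_pow_mul_zero (hsm _),
            if_pos hi', ih (n - i) (by omega) (by omega)]
        · intro i _ hi
          have hi' : ¬ i ≤ n := fun h => hi (mem_range.2 (by omega))
          rw [iteratedDeriv_const_mul_field, mul_div_assoc, iteratedDeriv_pow_mul_zero (hsm _),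
            if_neg hi', mul_zero]
      · intro i _
        exact contDiffAt_const.mul ((contDiffAt_id.pow i).mul
          ((hsm _).of_le (by exact_mod_cast le_top)))

/-- The Taylor coefficients of a shifted smooth function are given by the formal shift along the
derivations `ε ∂/∂vᵢ`. -/
theorem shiftCoeff_eq (v : ℕ+ → TodaVar k m) (ε : 𝕜) (f : smoothAlg Ω) (n : ℕ) :
    shiftCoeff v ε f.1 n =
      (PowerSeries.coeff n (shiftSeries (scaledDeriv Ω ε fun i => v i.succPNat)) f).1 := by
  funext p
  exact iteratedDeriv_curve ε (fun i => v i.succPNat) n n le_rfl f p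

end Smooth
end EBTH

namespace EBTH
open Finset DiffOp

/-! ### Inverses of difference operators -/

section Homogeneous
variable {𝕜 : Type*} [Field 𝕜] {R : Type*} [CommRing R] [Algebra 𝕜 R]

/-- The elements of `OpSeries` that are difference operators: the coefficient in degree `i` is of
the form `a σⁱ`. -/
def IsDiffOp (σ : R ≃ₐ[𝕜] R) (x : OpSeries 𝕜 R) : Prop :=
  ∀ i, ∃ a, x.coeff i = mulOp 𝕜 a * shiftOp σ i

theorem IsDiffOp.coeff_eq {σ : R ≃ₐ[𝕜] R} {x : OpSeries 𝕜 R} (h : IsDiffOp σ x) (i : ℤ) :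
    x.coeff i = mulOp 𝕜 (x.coeff i 1) * shiftOp σ i := by
  obtain ⟨a, ha⟩ := h i
  rw [ha]
  congr 2
  simp [shiftOp_apply]

theorem IsDiffOp.coeff_apply {σ : R ≃ₐ[𝕜] R} {x : OpSeries 𝕜 R} (h : IsDiffOp σ x) (i : ℤ) (b : R) :
    x.coeff i b = x.coeff i 1 * (σ ^ i) b := by
  conv_lhs => rw [h.coeff_eq i]
  rfl

theorem IsDiffOp.ext {σ : R ≃ₐ[𝕜] R} {x y : OpSeries 𝕜 R} (hx : IsDiffOp σ x) (hy : IsDiffOp σ y)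
    (h : ∀ i, x.coeff i 1 = y.coeff i 1) : x = y := by
  ext1
  ext1 i
  rw [hx.coeff_eq i, hy.coeff_eq i, h i]

theorem exists_sum_mulOp_mul {ι : Type*} (s : Finset ι) (f : ι → Module.End 𝕜 R)
    (S : Module.End 𝕜 R) (h : ∀ i ∈ s, ∃ a, f i = mulOp 𝕜 a * S) :
    ∃ a, ∑ i ∈ s, f i = mulOp 𝕜 a * S := by
  choose! a ha using h
  exact ⟨∑ i ∈ s, a i, by rw [map_sum, sum_mul]; exact sum_congr rfl ha⟩

theorem mulOp_mul_shiftOp_mul (σ : R ≃ₐ[𝕜] R) (a b : R) (i j : ℤ) :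
    mulOp 𝕜 a * shiftOp σ i * (mulOp 𝕜 b * shiftOp σ j) =
      mulOp 𝕜 (a * (σ ^ i) b) * shiftOp σ (i + j) := by
  rw [mul_assoc, ← mul_assoc (shiftOp σ i), shiftOp_mul_mulOp, shiftOp_add, map_mul]
  simp only [mul_assoc]

theorem IsDiffOp.mul {σ : R ≃ₐ[𝕜] R} {x y : OpSeries 𝕜 R} (hx : IsDiffOp σ x) (hy : IsDiffOp σ y) :
    IsDiffOp σ (x * y) := by
  intro n
  rw [HahnSeries.coeff_mul]
  refine exists_sum_mulOp_mul _ _ _ fun p hp => ?_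
  obtain ⟨a, ha⟩ := hx p.1
  obtain ⟨b, hb⟩ := hy p.2
  refine ⟨a * (σ ^ p.1) b, ?_⟩
  rw [ha, hb, mulOp_mul_shiftOp_mul, (Finset.mem_antidiagonal.1 hp).2.2]

theorem IsDiffOp.add {σ : R ≃ₐ[𝕜] R} {x y : OpSeries 𝕜 R} (hx : IsDiffOp σ x) (hy : IsDiffOp σ y) :
    IsDiffOp σ (x + y) := by
  intro n
  obtain ⟨a, ha⟩ := hx n
  obtain ⟨b, hb⟩ := hy n
  exact ⟨a + b, by rw [HahnSeries.coeff_add, ha, hb, map_add, add_mul]⟩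

theorem isDiffOp_zero (σ : R ≃ₐ[𝕜] R) : IsDiffOp σ 0 := fun _ => ⟨0, by simp⟩

theorem isDiffOp_thetaPow (σ : R ≃ₐ[𝕜] R) (j : ℤ) : IsDiffOp σ (thetaPow σ j) := by
  intro n
  rcases eq_or_ne n j with rfl | h
  · exact ⟨1, by rw [thetaPow, HahnSeries.coeff_single_same, map_one, one_mul]⟩
  · exact ⟨0, by rw [thetaPow, HahnSeries.coeff_single_of_ne h, map_zero, zero_mul]⟩

theorem coeff_ofPowerSeries_of_neg {A : Type*} [Semiring A] (x : PowerSeries A) {i : ℤ}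
    (hi : i < 0) :
    (HahnSeries.ofPowerSeries ℤ A x).coeff i = 0 := by
  rw [HahnSeries.ofPowerSeries_apply]
  refine HahnSeries.embDomain_of_notMem_range ?_
  rintro ⟨n, rfl⟩
  exact absurd hi (by simp)

theorem isDiffOp_ofPowerSeries (σ : R ≃ₐ[𝕜] R) (a : ℕ → R) :
    IsDiffOp σ (HahnSeries.ofPowerSeries ℤ _ (opPower σ a)) := by
  intro i
  rcases lt_or_ge i 0 with h | h
  · exact ⟨0, by rw [coeff_ofPowerSeries_of_neg _ h, map_zero, zero_mul]⟩
  · lift i to ℕ using h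
    exact ⟨a i, by rw [HahnSeries.ofPowerSeries_apply_coeff, opPower, PowerSeries.coeff_mk]⟩

/-- A difference operator `∑ wᵢ Θⁱ`, `i ≥ 0`, with invertible `w₀` has an inverse of that form. -/
theorem exists_opPower_inverse (σ : R ≃ₐ[𝕜] R) {w : ℕ → R} (hw : IsUnit (w 0)) :
    ∃ a : ℕ → R, opPower σ w * opPower σ a = 1 ∧ opPower σ a * opPower σ w = 1 := by
  obtain ⟨u, hu⟩ := hw
  set U : (Module.End 𝕜 R)ˣ :=
    Units.map ((mulOp 𝕜 : R →ₐ[𝕜] Module.End 𝕜 R) : R →* Module.End 𝕜 R) u with hU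
  have h0 : PowerSeries.constantCoeff (opPower σ w) = U := by
    rw [← PowerSeries.coeff_zero_eq_constantCoeff_apply, opPower, PowerSeries.coeff_mk,
      Nat.cast_zero, shiftOp_zero, mul_one, hU, Units.coe_map, hu]
    rfl
  have hUi : (↑U⁻¹ : Module.End 𝕜 R) = mulOp 𝕜 (↑u⁻¹ : R) := by
    rw [hU, ← map_inv, Units.coe_map]
    rfl
  have hV : ∀ n, ∃ a, PowerSeries.coeff n (PowerSeries.invOfUnit (opPower σ w) U) =
      mulOp 𝕜 a * shiftOp σ n := by
    intro n
    induction n using Nat.strong_induction_on with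
    | _ n ih =>
      rw [PowerSeries.coeff_invOfUnit]
      split_ifs with hn
      · exact ⟨↑u⁻¹, by rw [hn, Nat.cast_zero, shiftOp_zero, mul_one, hUi]⟩
      · obtain ⟨b, hb⟩ := exists_sum_mulOp_mul (antidiagonal n) (fun x => if x.2 < n then
          PowerSeries.coeff x.1 (opPower σ w) *
            PowerSeries.coeff x.2 (PowerSeries.invOfUnit (opPower σ w) U) else 0) (shiftOp σ n)
          (fun p hp => by
            split_ifs with hp2
            · obtain ⟨b, hb⟩ := ih p.2 hp2
              refine ⟨w p.1 * (σ ^ (p.1 : ℤ)) b, ?_⟩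
              rw [hb, opPower, PowerSeries.coeff_mk, mulOp_mul_shiftOp_mul, ← Nat.cast_add,
                HasAntidiagonal.mem_antidiagonal.1 hp]
            · exact ⟨0, by rw [map_zero, zero_mul]⟩)
        refine ⟨-↑u⁻¹ * b, ?_⟩
        rw [hb, hUi, map_mul, map_neg, mul_assoc]
  choose a ha using hV
  have hinv : opPower σ a = PowerSeries.invOfUnit (opPower σ w) U := by
    ext1 n
    rw [ha, opPower, PowerSeries.coeff_mk]
  exact ⟨a, by rw [hinv, PowerSeries.mul_invOfUnit _ _ h0],
    by rw [hinv, PowerSeries.invOfUnit_mul _ _ h0]⟩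

end Homogeneous

/-! ### Comparison of the two models of difference operators -/

section Realisation
variable {𝕜 : Type*} [RCLike 𝕜] {k m : ℕ+} {Ω : Domain 𝕜 k m}

/-- The difference operator in `Λ` that corresponds to a difference operator in `Θ = Λᵉ`,
`e = ±1`. -/
def toDiffOp (e : ℤ) (x : OpSeries 𝕜 (smoothAlg Ω)) : DiffOp Ω := fun i => (x.coeff (e * i) 1).1

theorem DiffOp.mul_apply (A B : DiffOp Ω) (n : ℤ) (p : Ω.carrier) :
    (A * B) n p = ∑ᶠ i : ℤ, A i p * Fn.shift i (B (n - i)) p := rfl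

theorem exists_finset_coeff_mul {A : Type*} [Ring A] (x y : HahnSeries ℤ A) (n : ℤ) :
    ∃ s : Finset ℤ, (∀ i ∉ s, x.coeff i = 0 ∨ y.coeff (n - i) = 0) ∧
      (x * y).coeff n = ∑ i ∈ s, x.coeff i * y.coeff (n - i) := by
  refine ⟨(Finset.antidiagonal x.isPWO_support y.isPWO_support n).image Prod.fst, ?_, ?_⟩
  · intro i hi
    by_contra! h
    exact hi (mem_image.2 ⟨(i, n - i), Finset.mem_antidiagonal.2 ⟨h.1, h.2, by simp⟩, rfl⟩)
  · rw [HahnSeries.coeff_mul, sum_image]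
    · refine sum_congr rfl fun p hp => ?_
      rw [← (Finset.mem_antidiagonal.1 hp).2.2, add_sub_cancel_left]
    · intro p hp q hq h
      have h1 := (Finset.mem_antidiagonal.1 hp).2.2
      have h2 := (Finset.mem_antidiagonal.1 hq).2.2
      refine Prod.ext h ?_
      have h' : p.1 = q.1 := h
      omega

/-- The map to `DiffOp` is multiplicative; the finite sums of the product of Hahn series are those
in the product of difference operators, as `σ = Λᵉ`. -/
theorem toDiffOp_mul {e : ℤ} (he : e * e = 1) {x : OpSeries 𝕜 (smoothAlg Ω)}
    (hx : IsDiffOp (shiftEquiv Ω e) x) (y : OpSeries 𝕜 (smoothAlg Ω)) :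
    toDiffOp e (x * y) = toDiffOp e x * toDiffOp e y := by
  have hee : ∀ i, e * (e * i) = i := fun i => by rw [← mul_assoc, he, one_mul]
  funext n p
  obtain ⟨s, hs0, hs⟩ := exists_finset_coeff_mul (A := Module.End 𝕜 (smoothAlg Ω)) x y (e * n)
  rw [DiffOp.mul_apply, finsum_eq_sum_of_support_subset (s := s.image (e * ·))]
  · rw [sum_image (fun i _ j _ h => by
      have h' : e * i = e * j := h
      rw [← hee i, h', hee])]
    rw [toDiffOp, hs, LinearMap.sum_apply, AddSubmonoidClass.coe_finsetSum, Finset.sum_apply]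
    refine sum_congr rfl fun i _ => ?_
    rw [Module.End.mul_apply, hx.coeff_apply]
    simp only [toDiffOp, hee, mul_sub]
    rw [← coe_shiftEquiv_zpow]
    rfl
  · intro i hi
    by_contra hi'
    have hei : e * i ∉ s := fun h => hi' (mem_coe.2 (mem_image.2 ⟨e * i, h, hee i⟩))
    refine hi ?_
    rcases hs0 _ hei with h | h
    · simp [toDiffOp, h]
    · simp [toDiffOp, mul_sub, h, Fn.shift]

theorem toDiffOp_add (e : ℤ) (x y : OpSeries 𝕜 (smoothAlg Ω)) :
    toDiffOp e (x + y) = toDiffOp e x + toDiffOp e y := rfl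

theorem toDiffOp_thetaPow {e : ℤ} (he : e * e = 1) (j : ℤ) :
    toDiffOp e (thetaPow (shiftEquiv Ω e) j) = lam (e * j) := by
  have hee : ∀ i, e * (e * i) = i := fun i => by rw [← mul_assoc, he, one_mul]
  funext i
  rw [toDiffOp, thetaPow, lam]
  split_ifs with h
  · rw [h, hee, HahnSeries.coeff_single_same, shiftOp_apply, map_one]
    rfl
  · rw [HahnSeries.coeff_single_of_ne (fun h' => h (by rw [← h', hee]))]
    rfl

theorem toDiffOp_one {e : ℤ} (he : e * e = 1) :
    toDiffOp e (1 : OpSeries 𝕜 (smoothAlg Ω)) = 1 := by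
  rw [← thetaPow_zero (shiftEquiv Ω e), toDiffOp_thetaPow he, mul_zero]
  rfl

theorem toDiffOp_injective {e : ℤ} (he : e * e = 1) {x y : OpSeries 𝕜 (smoothAlg Ω)}
    (hx : IsDiffOp (shiftEquiv Ω e) x) (hy : IsDiffOp (shiftEquiv Ω e) y)
    (h : toDiffOp e x = toDiffOp e y) : x = y := by
  refine hx.ext hy fun i => Subtype.ext ?_
  have := congrFun h (e * i)
  rwa [toDiffOp, toDiffOp, ← mul_assoc, he, one_mul] at this

/-- The difference operators with powers of `Λᵉ` bounded from below. -/
def bdd (Ω : Domain 𝕜 k m) (e : ℤ) : Set (DiffOp Ω) := {A | ∃ N : ℤ, ∀ i, e * i < N → A i = 0}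

theorem bdd_one : bdd Ω 1 = bddBelow Ω := by
  ext A
  simp [bdd, bddBelow]

theorem bdd_neg_one : bdd Ω (-1) = bddAbove Ω := by
  ext A
  constructor
  · rintro ⟨N, hN⟩
    exact ⟨-N, fun i hi => hN i (by omega)⟩
  · rintro ⟨N, hN⟩
    exact ⟨-N, fun i hi => hN i (by omega)⟩

/-- A difference operator `∑ aᵢ Λᵉⁱ`, `i ≥ 0`, with nowhere vanishing `a₀` can be cancelled on the
left. -/
theorem DiffOp.mul_left_cancel {e : ℤ} (he : e * e = 1) {A B B' : DiffOp Ω}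
    (hA : ∀ i, e * i < 0 → A i = 0) (hA0 : ∀ p, A 0 p ≠ 0) (hB : B ∈ bdd Ω e) (hB' : B' ∈ bdd Ω e)
    (h : A * B = A * B') : B = B' := by
  have hee : ∀ i, e * (e * i) = i := fun i => by rw [← mul_assoc, he, one_mul]
  obtain ⟨N, hN⟩ := hB
  obtain ⟨N', hN'⟩ := hB'
  have hM : ∀ i, e * i < min N N' → B i = 0 ∧ B' i = 0 := fun i hi =>
    ⟨hN i (by omega), hN' i (by omega)⟩
  generalize min N N' = M at hM
  -- The coefficients are compared by increasing powers of `Λᵉ`, starting where both vanish.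
  have key : ∀ n : ℕ, ∀ i, e * i < M + n → B i = B' i := by
    intro n
    induction n with
    | zero =>
      intro i hi
      rw [(hM i (by simpa using hi)).1, (hM i (by simpa using hi)).2]
    | succ n ih =>
      intro i hi
      funext p
      -- Only finitely many terms contribute, so the sums defining the products may be subtracted;
      -- by induction, the terms with `j ≠ 0` cancel.
      have hfin : ∀ C : DiffOp Ω, (∀ i, e * i < M → C i = 0) →
          (Function.support fun j => A j p * Fn.shift j (C (i - j)) p).Finite := by
        intro C hC
        refine ((Set.finite_Icc 0 (n : ℤ)).image (e * ·)).subset fun j hj => ?_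
        refine ⟨e * j, ⟨?_, ?_⟩, hee j⟩
        · by_contra hlt
          exact hj (by simp [hA j (by omega)])
        · by_contra hlt
          refine hj ?_
          have : C (i - j) = 0 := hC _ (by rw [mul_sub]; push_cast at hi; omega)
          simp [this, Fn.shift]
      have h1 := congrFun (congrFun h i) p
      rw [DiffOp.mul_apply, DiffOp.mul_apply, ← sub_eq_zero,
        ← finsum_sub_distrib (hfin B fun i hi => (hM i hi).1) (hfin B' fun i hi => (hM i hi).2),
        finsum_eq_single _ 0] at h1
      · rw [sub_zero, Fn.shift_zero, Fn.shift_zero, ← mul_sub] at h1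
        exact sub_eq_zero.1 ((mul_eq_zero.1 h1).resolve_left (hA0 p))
      · intro j hj
        rcases lt_trichotomy (e * j) 0 with hlt | heq | hgt
        · simp [hA j hlt]
        · exact absurd (by rw [← hee j, heq, mul_zero]) hj
        · rw [ih (i - j) (by rw [mul_sub]; push_cast at hi; omega), sub_self]
  funext i
  exact key (e * i - M + 1).toNat i (by omega)

/-- The inverse that `inv` chooses is any two-sided inverse found in the same space: the inverse is
unique, because `A` can be cancelled. -/
theorem DiffOp.inv_eq {e : ℤ} (he : e * e = 1) {A B : DiffOp Ω}
    (hA : ∀ i, e * i < 0 → A i = 0) (hA0 : ∀ p, A 0 p ≠ 0) (hB : B ∈ bdd Ω e)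
    (hAB : A * B = 1) (hBA : B * A = 1) : inv (bdd Ω e) A = B := by
  have h := Classical.epsilon_spec (p := fun B => B ∈ bdd Ω e ∧ A * B = 1 ∧ B * A = 1)
    ⟨B, hB, hAB, hBA⟩
  exact DiffOp.mul_left_cancel he hA hA0 h.1 hB (h.2.1.trans hAB.symm)

/-- The formal adjoint reverses products. -/
theorem DiffOp.adjoint_mul (A B : DiffOp Ω) : adjoint (A * B) = adjoint B * adjoint A := by
  funext n p
  rw [DiffOp.mul_apply]
  change ∑ᶠ i : ℤ, A i (Ω.shift n p) * Fn.shift i (B (-n - i)) (Ω.shift n p) = _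
  rw [← finsum_comp_equiv (Equiv.subRight n)]
  refine finsum_congr fun j => ?_
  simp only [adjoint, Fn.shift, Equiv.subRight_apply, Ω.shift_shift]
  rw [mul_comm]
  congr 3 <;> ring_nf

theorem DiffOp.adjoint_one : adjoint (1 : DiffOp Ω) = 1 := by
  funext n p
  change Fn.shift n (if -n = 0 then 1 else 0 : Fn Ω) p = (if n = 0 then 1 else 0 : Fn Ω) p
  by_cases h : n = 0 <;> simp [h, Fn.shift]

end Realisation
end EBTH

namespace EBTH
open Finset DiffOp

/-! ### Sato equations -/

section Sato
variable {𝕜 : Type*} [RCLike 𝕜] {k m : ℕ+} {Ω : Domain 𝕜 k m}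

/-- The operator `[d, W]` has the coefficients `d wᵢ`. -/
theorem C_deriv_mul_opPower {R : Type*} [CommRing R] [Algebra 𝕜 R] {σ : R ≃ₐ[𝕜] R}
    (d : Derivation 𝕜 R R) (hd : ∀ a, d (σ a) = σ (d a)) (w : ℕ → R) :
    HahnSeries.C (d : Module.End 𝕜 R) * HahnSeries.ofPowerSeries ℤ _ (opPower σ w) =
      HahnSeries.ofPowerSeries ℤ _ (opPower σ fun i => d (w i)) +
        HahnSeries.ofPowerSeries ℤ _ (opPower σ w) * HahnSeries.C (d : Module.End 𝕜 R) := by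
  rw [← HahnSeries.ofPowerSeries_C, ← map_mul, ← map_mul, ← map_add]
  congr 1
  ext1 i
  rw [map_add, PowerSeries.coeff_C_mul, PowerSeries.coeff_mul_C]
  simp only [opPower, PowerSeries.coeff_mk]
  rw [mul_assoc, (commute_shiftOp (d := (d : Module.End 𝕜 R)) hd i).eq, ← mul_assoc, ← mul_assoc,
    ← add_mul, deriv_comm_mulOp, sub_add_cancel]

/-- The part of degree less than `c` of a difference operator. -/
def truncOp {R : Type*} [CommRing R] [Algebra 𝕜 R] (c : ℤ) (x : OpSeries 𝕜 R) : OpSeries 𝕜 R :=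
  HahnSeries.truncLT c x

theorem coeff_truncOp_of_lt {R : Type*} [CommRing R] [Algebra 𝕜 R] {c i : ℤ} (h : i < c)
    (x : OpSeries 𝕜 R) : (truncOp c x).coeff i = x.coeff i := HahnSeries.coeff_truncLT_of_lt h x

theorem coeff_truncOp_of_le {R : Type*} [CommRing R] [Algebra 𝕜 R] {c i : ℤ} (h : c ≤ i)
    (x : OpSeries 𝕜 R) : (truncOp c x).coeff i = 0 := HahnSeries.coeff_truncLT_of_le h x

/-- The part of degree at least `c` of a difference operator. -/
def highOp {R : Type*} [CommRing R] [Algebra 𝕜 R] (c : ℤ) (x : OpSeries 𝕜 R) : OpSeries 𝕜 R :=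
  x - truncOp c x

theorem truncOp_add_highOp {R : Type*} [CommRing R] [Algebra 𝕜 R] (c : ℤ) (x : OpSeries 𝕜 R) :
    truncOp c x + highOp c x = x :=
  add_sub_cancel (truncOp c x) x

theorem coeff_highOp {R : Type*} [CommRing R] [Algebra 𝕜 R] (c i : ℤ) (x : OpSeries 𝕜 R) :
    (highOp c x).coeff i = if c ≤ i then x.coeff i else 0 := by
  rw [highOp, HahnSeries.coeff_sub]
  split_ifs with h
  · rw [coeff_truncOp_of_le h, sub_zero]
  · rw [coeff_truncOp_of_lt (not_le.1 h), sub_self]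

theorem IsDiffOp.highOp {R : Type*} [CommRing R] [Algebra 𝕜 R] {σ : R ≃ₐ[𝕜] R} (c : ℤ)
    {x : OpSeries 𝕜 R} (hx : IsDiffOp σ x) : IsDiffOp σ (highOp c x) := by
  intro i
  rw [coeff_highOp]
  split_ifs with h
  · exact hx i
  · exact ⟨0, by rw [map_zero, zero_mul]⟩

/-- The Sato equation `d W = -(W Θʲ V)_{≥ c} W` in the form `[d, W] + W Θʲ = (W Θʲ V)_{< c} W`. -/
theorem dressing_flow {R : Type*} [CommRing R] [Algebra 𝕜 R] {σ : R ≃ₐ[𝕜] R}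
    (d : Derivation 𝕜 R R) (hd : ∀ a, d (σ a) = σ (d a)) (w : ℕ → R) {V : OpSeries 𝕜 R}
    (hVW : V * HahnSeries.ofPowerSeries ℤ _ (opPower σ w) = 1) (c j : ℤ)
    (h : HahnSeries.ofPowerSeries ℤ _ (opPower σ fun i => d (w i)) +
      highOp c (HahnSeries.ofPowerSeries ℤ _ (opPower σ w) * thetaPow σ j * V) *
        HahnSeries.ofPowerSeries ℤ _ (opPower σ w) = 0) :
    HahnSeries.C (d : Module.End 𝕜 R) * HahnSeries.ofPowerSeries ℤ _ (opPower σ w) +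
        HahnSeries.ofPowerSeries ℤ _ (opPower σ w) * thetaPow σ j =
      truncOp c (HahnSeries.ofPowerSeries ℤ _ (opPower σ w) * thetaPow σ j * V) *
        HahnSeries.ofPowerSeries ℤ _ (opPower σ w) +
        HahnSeries.ofPowerSeries ℤ _ (opPower σ w) * HahnSeries.C (d : Module.End 𝕜 R) := by
  rw [C_deriv_mul_opPower d hd]
  set W := HahnSeries.ofPowerSeries ℤ _ (opPower σ w)
  have h1 : W * thetaPow σ j = (truncOp c (W * thetaPow σ j * V) +
      highOp c (W * thetaPow σ j * V)) * W := by
    rw [truncOp_add_highOp, mul_assoc _ V, hVW, mul_one]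
  conv_lhs => rw [h1]
  rw [add_mul, add_add_add_comm, add_comm _ (W * _), add_comm (W * _), add_add_add_comm, h,
    zero_add, add_comm]

/-- The Sato equations `Dᵢ W = -(W Θ⁻ⁱ⁻¹ W⁻¹)_{≥ c} W` and the formula `∑ wᵢ uⁱ = T⁻¹(ρ) / τ` for
the coefficients of `W` determine the coefficients of `W⁻¹ = ∑ aₙ Θⁿ`. -/
theorem dressing_inverse_of_sato {R : Type*} [CommRing R] [Algebra 𝕜 R] (σ : R ≃ₐ[𝕜] R)
    (D : ℕ → Derivation 𝕜 R R) (hσ : ∀ i a, D i (σ a) = σ (D i a))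
    (hD : ∀ i j, Commute (D i : Module.End 𝕜 R) (D j : Module.End 𝕜 R))
    (c : ℕ) (w a : ℕ → R) (hc : c = 0 ∨ c = 1 ∧ w 0 = 1)
    (hWV : opPower σ w * opPower σ a = 1) (hVW : opPower σ a * opPower σ w = 1)
    (hsato : ∀ i : ℕ, HahnSeries.ofPowerSeries ℤ _ (opPower σ fun j => D i (w j)) +
      highOp c (HahnSeries.ofPowerSeries ℤ _ (opPower σ w) * thetaPow σ (-((i + 1 : ℕ) : ℤ)) *
          HahnSeries.ofPowerSeries ℤ _ (opPower σ a)) *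
        HahnSeries.ofPowerSeries ℤ _ (opPower σ w) = 0)
    (τ ρ : R) (hw : ∀ i, w i * τ = PowerSeries.coeff i (shiftSeries fun i => -D i) ρ) (n : ℕ) :
    (σ ^ ((c : ℤ) - n)) (a n) * ρ = PowerSeries.coeff n (shiftSeries D) τ := by
  have ha : (fun j : ℕ => (σ ^ (j : ℤ)) ((σ ^ (-(j : ℤ))) (a j))) = a := by
    funext j
    rw [← AlgEquiv.mul_apply, ← zpow_add, add_neg_cancel, zpow_zero, AlgEquiv.one_apply]
  have hn := dressing_inverse_tau σ D hσ hD c w (fun j => (σ ^ (-(j : ℤ))) (a j)) hc _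
    (by rw [ha, hWV]) (fun i j hj => coeff_truncOp_of_le (by omega) _)
    (fun i => dressing_flow (D i) (hσ i) w (by rw [← map_mul, hVW, map_one]) c _ (hsato i)) τ ρ hw n
  rw [sub_eq_add_neg, zpow_add, AlgEquiv.mul_apply]
  exact hn

/-- The part of a difference operator that consists of the powers `Λᵉⁱ` with `i ≥ c`. -/
def projGE (e c : ℤ) (A : DiffOp Ω) : DiffOp Ω := fun i => if c ≤ e * i then A i else 0

theorem toDiffOp_opPower_of_neg {e : ℤ} (b : ℕ → smoothAlg Ω) {i : ℤ} (hi : e * i < 0) :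
    toDiffOp e (HahnSeries.ofPowerSeries ℤ _ (opPower (shiftEquiv Ω e) b)) i = 0 := by
  rw [toDiffOp, coeff_ofPowerSeries_of_neg _ hi]
  rfl

theorem toDiffOp_opPower_natCast {e : ℤ} (he : e * e = 1) (b : ℕ → smoothAlg Ω) (n : ℕ) :
    toDiffOp e (HahnSeries.ofPowerSeries ℤ _ (opPower (shiftEquiv Ω e) b)) (e * n) = (b n).1 := by
  rw [toDiffOp, ← mul_assoc, he, one_mul, HahnSeries.ofPowerSeries_apply_coeff, opPower,
    PowerSeries.coeff_mk, Module.End.mul_apply, shiftOp_apply, map_one, mulOp_apply, mul_one]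

theorem toDiffOp_opPower {e : ℤ} (he : e * e = 1) {b : ℕ → smoothAlg Ω} {A : DiffOp Ω}
    (hneg : ∀ i, e * i < 0 → A i = 0) (hnat : ∀ n : ℕ, A (e * n) = (b n).1) :
    toDiffOp e (HahnSeries.ofPowerSeries ℤ _ (opPower (shiftEquiv Ω e) b)) = A := by
  have hee : ∀ i, e * (e * i) = i := fun i => by rw [← mul_assoc, he, one_mul]
  funext i
  rcases lt_or_ge (e * i) 0 with h | h
  · rw [toDiffOp_opPower_of_neg _ h, hneg i h]
  · obtain ⟨n, hn⟩ := Int.eq_ofNat_of_zero_le h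
    rw [← hee i, hn, toDiffOp_opPower_natCast he, hnat]

/-- The Sato equation for difference operators, transported to `OpSeries`. -/
theorem sato_equation_opSeries {e : ℤ} (he : e * e = 1) (c j : ℤ) {w a w' : ℕ → smoothAlg Ω}
    {W W' : DiffOp Ω}
    (hW : toDiffOp e (HahnSeries.ofPowerSeries ℤ _ (opPower (shiftEquiv Ω e) w)) = W)
    (hW' : toDiffOp e (HahnSeries.ofPowerSeries ℤ _ (opPower (shiftEquiv Ω e) w')) = W')
    (hinv : inv (bdd Ω e) W =
      toDiffOp e (HahnSeries.ofPowerSeries ℤ _ (opPower (shiftEquiv Ω e) a)))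
    (hflow : W' = -(projGE e c (W * lam (e * j) * inv (bdd Ω e) W) * W)) :
    HahnSeries.ofPowerSeries ℤ _ (opPower (shiftEquiv Ω e) w') +
      highOp c (HahnSeries.ofPowerSeries ℤ _ (opPower (shiftEquiv Ω e) w) *
          thetaPow (shiftEquiv Ω e) j *
          HahnSeries.ofPowerSeries ℤ _ (opPower (shiftEquiv Ω e) a)) *
        HahnSeries.ofPowerSeries ℤ _ (opPower (shiftEquiv Ω e) w) = 0 := by
  have hdW := isDiffOp_ofPowerSeries (shiftEquiv Ω e) w
  have hdL := (hdW.mul (isDiffOp_thetaPow (shiftEquiv Ω e) j)).mul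
    (isDiffOp_ofPowerSeries (shiftEquiv Ω e) a)
  have htU : ∀ x : OpSeries 𝕜 (smoothAlg Ω),
      toDiffOp e (highOp c x) = projGE e c (toDiffOp e x) := by
    intro x
    funext j
    rw [toDiffOp, coeff_highOp, projGE]
    split_ifs <;> rfl
  refine toDiffOp_injective he ((isDiffOp_ofPowerSeries _ w').add ((hdL.highOp c).mul hdW))
    (isDiffOp_zero _) ?_
  rw [toDiffOp_add, hW', toDiffOp_mul he (hdL.highOp c), htU,
    toDiffOp_mul he (hdW.mul (isDiffOp_thetaPow _ j)), toDiffOp_mul he hdW, toDiffOp_thetaPow he,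
    hW, ← hinv, hflow, neg_add_cancel]
  rfl

/-- A tau-function of a wave operator determines the inverse operator. Let `W = ∑ wᵢ Λᵉⁱ`, `i ≥ 0`,
`e = ±1`, satisfy the Sato equations `ε ∂W/∂vₙ = -(W Λ⁻ᵉⁿ W⁻¹)_{≥ c} W`, where `c = 0`, or `c = 1`
and `w₀ = 1`. If `∑ wᵢ uⁱ = ρ(v - ε[u]) / τ(v)`, then the coefficients `Vₙ` of `Λᵉⁿ` in `W⁻¹` are
given by `∑ Vₙ(s + e(c - n)) uⁿ = τ(v + ε[u]) / ρ(v)`. -/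
theorem sato_inverse {e : ℤ} (he : e * e = 1) (c : ℕ) (ε : 𝕜) (v : ℕ+ → TodaVar k m) {W : DiffOp Ω}
    (hWs : ∀ i, (W i).Smooth) (hWneg : ∀ i, e * i < 0 → W i = 0) (hW0 : ∀ p, W 0 p ≠ 0)
    (hc : c = 0 ∨ c = 1 ∧ W 0 = 1)
    (hflow : ∀ n : ℕ+, ε • pd (v n) W =
      -(projGE e c (W * lam (-(e * n)) * inv (bdd Ω e) W) * W))
    {τ ρ : Fn Ω} (hτ : τ.Smooth) (hρ : ρ.Smooth)
    (hw : ∀ i : ℕ, W (e * i) * τ = shiftCoeff v (-ε) ρ i) :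
    ∃ V : DiffOp Ω, (∀ i, e * i < 0 → V i = 0) ∧ W * V = 1 ∧ V * W = 1 ∧
      ∀ n : ℕ, Fn.shift (e * (c - n)) (V (e * n)) * ρ = shiftCoeff v ε τ n := by
  obtain ⟨w, hw1⟩ : ∃ w : ℕ → smoothAlg Ω, ∀ n : ℕ, W (e * n) = (w n).1 :=
    ⟨fun n => ⟨W (e * n), hWs _⟩, fun n => rfl⟩
  have hw0 : W 0 = (w 0).1 := by simpa using hw1 0
  have hunit : IsUnit (w 0) := by
    refine IsUnit.of_mul_eq_one ⟨(W 0)⁻¹, (hWs 0).inv hW0⟩ ?_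
    refine Subtype.ext (funext fun p => ?_)
    simp [← hw0, hW0 p]
  obtain ⟨a, hWa, haW⟩ := exists_opPower_inverse (shiftEquiv Ω e) hunit
  have hdW := isDiffOp_ofPowerSeries (shiftEquiv Ω e) w
  have hdV := isDiffOp_ofPowerSeries (shiftEquiv Ω e) a
  have htW := toDiffOp_opPower he hWneg hw1
  set V := toDiffOp e (HahnSeries.ofPowerSeries ℤ _ (opPower (shiftEquiv Ω e) a)) with hV
  have hVneg : ∀ i, e * i < 0 → V i = 0 := fun i hi => toDiffOp_opPower_of_neg a hi
  have hmulWV : W * V = 1 := by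
    rw [← htW, hV, ← toDiffOp_mul he hdW, ← map_mul, hWa, map_one, toDiffOp_one he]
  have hmulVW : V * W = 1 := by
    rw [← htW, hV, ← toDiffOp_mul he hdV, ← map_mul, haW, map_one, toDiffOp_one he]
  have hinv : inv (bdd Ω e) W = V := DiffOp.inv_eq he hWneg hW0 ⟨0, hVneg⟩ hmulWV hmulVW
  refine ⟨V, hVneg, hmulWV, hmulVW, fun n => ?_⟩
  have hw' : ∀ i, w i * ⟨τ, hτ⟩ = PowerSeries.coeff i
      (shiftSeries fun i => -scaledDeriv Ω ε (fun i => v i.succPNat) i) ⟨ρ, hρ⟩ := by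
    intro i
    refine Subtype.ext ?_
    simp only [neg_scaledDeriv]
    rw [← shiftCoeff_eq, ← hw i, hw1]
    rfl
  have hn := congrArg Subtype.val (dressing_inverse_of_sato (shiftEquiv Ω e)
    (scaledDeriv Ω ε fun i => v i.succPNat) (scaledDeriv_shiftEquiv ε _ e)
    (commute_scaledDeriv ε _) c w a (hc.imp_right fun h => ⟨h.1, Subtype.ext (hw0.symm.trans h.2)⟩)
    hWa haW (fun i => sato_equation_opSeries he c _ htW
      (toDiffOp_opPower he (A := ε • pd (v i.succPNat) W) (fun j hj => ?_) fun n => ?_) hinv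
      (by rw [hflow, mul_neg]; rfl)) ⟨τ, hτ⟩ ⟨ρ, hρ⟩ hw' n)
  · rw [← shiftCoeff_eq v ε ⟨τ, hτ⟩ n] at hn
    have hVn : V (e * n) = (a n).1 := toDiffOp_opPower_natCast he a n
    rw [← hn, hVn, ← coe_shiftEquiv_zpow]
    rfl
  · have : Fn.pd (v i.succPNat) (0 : Fn Ω) = 0 := by
      simpa using Fn.pd_smul (0 : Fn Ω) (0 : 𝕜) (v i.succPNat)
    change ε • Fn.pd (v i.succPNat) (W j) = 0
    rw [hWneg j hj, this, smul_zero]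
  · rw [coe_scaledDeriv, ← hw1]
    rfl

end Sato

/-! ### Wave functions -/

section Waves
variable {𝕜 : Type*} [RCLike 𝕜] {k m : ℕ+} {Ω : Domain 𝕜 k m}

theorem shift_coord_of_ne {v : TodaVar k m} (hv : v ≠ TodaVar.s) (j : ℤ) :
    Fn.shift j (coord v : Fn Ω) = coord v := by
  funext p
  have h : unitVec 𝕜 (TodaVar.s : TodaVar k m) v = 0 := by
    classical
    exact Pi.single_eq_of_ne hv _
  simp [Fn.shift, Domain.shift, coord, h]

theorem shift_coord_s (j : ℤ) (p : Ω.carrier) :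
    Fn.shift j (coord TodaVar.s : Fn Ω) p = coord TodaVar.s p + j := by
  simp [Fn.shift, Domain.shift, coord, unitVec]

theorem TodaVar.tbar_ne_s (j : ℕ+) : (TodaVar.tbar j : TodaVar k m) ≠ TodaVar.s := by
  unfold TodaVar.tbar TodaVar.s
  split_ifs <;> simp

/-- `Λʲ χ = zʲ χ`. -/
theorem shift_chi (j : ℤ) : Phase.shift j (chi Ω) = chi Ω + Phase.logz j := by
  have ht : ∀ i, Fn.shift j (coord (TodaVar.t i) : Fn Ω) = coord (TodaVar.t i) := fun i =>
    shift_coord_of_ne (by simp [TodaVar.s]) j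
  refine Prod.ext (funext fun i => funext fun p => ?_) (funext fun i => funext fun p => ?_)
  · by_cases hi : i = 0
    · subst hi
      simpa [Phase.shift, chi, Phase.logz, Fn.shift, TodaVar.s] using shift_coord_s j p
    · simp only [Phase.shift, chi, Phase.logz, hi, if_false, Prod.fst_add, Pi.add_apply,
        Pi.zero_apply, add_zero]
      split_ifs with h
      · rw [shift_coord_of_ne]
        obtain ⟨h0, d, rfl⟩ := h
        have hk : (0 : ℤ) < k := by exact_mod_cast k.pos
        have hd : 0 < d := by
          rcases lt_trichotomy d 0 with h | h | h
          · nlinarith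
          · exact absurd (by rw [h, mul_zero]) hi
          · exact h
        rw [Int.mul_ediv_cancel_left _ hk.ne']
        simp only [TodaVar.s, ne_eq, TodaVar.x.injEq]
        omega
      · rfl
  · simp only [Phase.shift, chi, Phase.logz, Prod.snd_add, Pi.add_apply, Pi.zero_apply, add_zero]
    split_ifs with h h'
    · have := congrFun (ht ⟨i.toNat, by omega⟩) p
      simp only [Fn.shift, Pi.sub_apply, Pi.smul_apply] at this ⊢
      rw [this]
    · have := congrFun (ht ⟨i.toNat, by omega⟩) p
      simp only [Fn.shift, Pi.sub_apply, Pi.zero_apply] at this ⊢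
      rw [this]
    · rfl

/-- `Λʲ χ̄ = zʲ χ̄`. -/
theorem shift_chiBar (j : ℤ) : Phase.shift j (chiBar Ω) = chiBar Ω + Phase.logz j := by
  have ht : ∀ i, Fn.shift j (coord (TodaVar.tbar i) : Fn Ω) = coord (TodaVar.tbar i) := fun i =>
    shift_coord_of_ne (TodaVar.tbar_ne_s i) j
  refine Prod.ext (funext fun i => funext fun p => ?_) (funext fun i => funext fun p => ?_)
  · by_cases hi : i = 0
    · subst hi
      simpa [Phase.shift, chiBar, Phase.logz, Fn.shift, TodaVar.s] using shift_coord_s j p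
    · simp only [Phase.shift, chiBar, Phase.logz, hi, if_false, Prod.fst_add, Pi.add_apply,
        Pi.zero_apply, add_zero]
      split_ifs with h
      · rw [shift_coord_of_ne]
        obtain ⟨h0, d, rfl⟩ := h
        have hk : (0 : ℤ) < m := by exact_mod_cast m.pos
        have hd : d < 0 := by
          rcases lt_trichotomy d 0 with h | h | h
          · exact h
          · exact absurd (by rw [h, mul_zero]) hi
          · nlinarith
        rw [← mul_neg, Int.mul_ediv_cancel_left _ hk.ne']
        simp only [TodaVar.s, ne_eq, TodaVar.x.injEq]
        omega
      · rfl
  · simp only [Phase.shift, chiBar, Phase.logz, Prod.snd_add, Pi.add_apply, Pi.zero_apply, add_zero]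
    split_ifs with h h'
    · have := congrFun (ht ⟨(-i).toNat, by omega⟩) p
      simp only [Fn.shift, Pi.add_apply, Pi.neg_apply, Pi.smul_apply] at this ⊢
      rw [this]
    · have := congrFun (ht ⟨(-i).toNat, by omega⟩) p
      simp only [Fn.shift, Pi.add_apply, Pi.neg_apply, Pi.zero_apply] at this ⊢
      rw [this]
    · rfl

theorem Phase.logz_neg (j : ℤ) : (Phase.logz (-j) : Phase Ω) = -Phase.logz j := by
  refine Prod.ext (funext fun i => funext fun p => ?_) (funext fun i => funext fun p => ?_)
  · by_cases hi : i = 0 <;> simp [Phase.logz, hi]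
  · simp [Phase.logz]

theorem Phase.shift_neg {θ : Phase Ω} (h : ∀ j, Phase.shift j θ = θ + Phase.logz j) (j : ℤ) :
    Phase.shift j (-θ) = -θ + Phase.logz (-1 * j) := by
  have : Phase.shift j (-θ) = -Phase.shift j θ := rfl
  rw [this, h, neg_add, neg_one_mul, Phase.logz_neg]

/-- If `Λʲ e^θ = z^{δj} e^θ`, `δ = ±1`, then the coefficient of `zⁿ` in `A e^θ` is the one of
`Λ^{δn}` in `A`. -/
theorem applyExp_amp {δ : ℤ} (hδ : δ * δ = 1) (A : DiffOp Ω) {θ : Phase Ω}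
    (h : ∀ j, Phase.shift j θ = θ + Phase.logz (δ * j)) (n : ℤ) :
    (applyExp A θ).amp n = A (δ * n) := by
  funext p
  have hiff : ∀ i, Phase.shift i θ = θ + Phase.logz n ↔ i = δ * n := by
    intro i
    rw [h, add_right_inj]
    constructor
    · intro h'
      have := congrFun (congrFun (congrArg Prod.fst h') 0) p
      simp only [Phase.logz, if_true] at this
      rw [← Int.cast_injective this, ← mul_assoc, hδ, one_mul]
    · rintro rfl
      rw [← mul_assoc, hδ, one_mul]
  simp only [applyExp, hiff]
  rw [finsum_eq_single _ (δ * n) (fun i hi => if_neg hi), if_pos rfl]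

theorem lam_mul_mul_lam (a b : ℤ) (A : DiffOp Ω) (n : ℤ) :
    (lam a * A * lam b : DiffOp Ω) n = Fn.shift a (A (n - a - b)) := by
  have h1 : ∀ (B : DiffOp Ω) n, (B * lam b : DiffOp Ω) n = B (n - b) := by
    intro B n
    funext p
    rw [DiffOp.mul_apply, finsum_eq_single _ (n - b)]
    · simp [lam, Fn.shift]
    · intro i hi
      have : n - i ≠ b := fun h => hi (by omega)
      simp [lam, this, Fn.shift]
  have h2 : ∀ n, (lam a * A : DiffOp Ω) n = Fn.shift a (A (n - a)) := by
    intro n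
    funext p
    rw [DiffOp.mul_apply, finsum_eq_single _ a]
    · simp [lam]
    · intro i hi
      simp [lam, hi]
  rw [h1, h2, sub_right_comm]

theorem shiftCoeff_shift (v : ℕ+ → TodaVar k m) (ε : 𝕜) (f : Fn Ω) (n : ℕ) (j : ℤ) :
    shiftCoeff v ε (Fn.shift j f) n = Fn.shift j (shiftCoeff v ε f n) := by
  funext p
  simp only [shiftCoeff, Fn.shift, Domain.shift, Fn.ext_shift]
  congr 2
  funext u
  rw [add_right_comm]

theorem tShift_shift (ε : 𝕜) (f : Fn Ω) (n j : ℤ) :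
    tShift ε (Fn.shift j f) n = Fn.shift j (tShift ε f n) := by
  rw [tShift, tShift]
  split_ifs
  · rw [shiftCoeff_shift]
  · rfl

theorem tbarShift_shift (ε : 𝕜) (f : Fn Ω) (n j : ℤ) :
    tbarShift ε (Fn.shift j f) n = Fn.shift j (tbarShift ε f n) := by
  rw [tbarShift, tbarShift]
  split_ifs
  · rw [shiftCoeff_shift]
  · rfl

/-- The coefficient of `zⁿ` in `V^* e^{-θ}`, where `e^θ` is `χ` or `χ̄`. -/
theorem applyExp_adjoint_amp (V : DiffOp Ω) {θ : Phase Ω}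
    (h : ∀ j, Phase.shift j θ = θ + Phase.logz j) (n : ℤ) :
    (applyExp (adjoint V) (-θ)).amp n = Fn.shift (-n) (V n) := by
  rw [applyExp_amp (by norm_num) _ (Phase.shift_neg h), neg_one_mul, adjoint, neg_neg]

/-- Conjugation of an operator by `Λ` shifts `s` in its symbol. -/
theorem applyExp_conj_lam_amp (A : DiffOp Ω) {θ : Phase Ω}
    (h : ∀ j, Phase.shift j θ = θ + Phase.logz j) (n : ℤ) :
    (applyExp (lam (-1) * A * lam 1) (-θ)).amp n = Fn.shift (-1) ((applyExp A (-θ)).amp n) := by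
  rw [applyExp_amp (by norm_num) _ (Phase.shift_neg h),
    applyExp_amp (by norm_num) _ (Phase.shift_neg h),
    lam_mul_mul_lam]
  congr 2
  ring

/-- The adjoint of the inverse is the inverse of the adjoint, in the space of operators that are
bounded on the other side. -/
theorem inv_adjoint {e : ℤ} (he : e * e = 1) {W V : DiffOp Ω} (hWneg : ∀ i, e * i < 0 → W i = 0)
    (hW0 : ∀ p, W 0 p ≠ 0) (hVneg : ∀ i, e * i < 0 → V i = 0) (hWV : W * V = 1) (hVW : V * W = 1) :
    inv (bdd Ω (-e)) (adjoint W) = adjoint V := by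
  refine DiffOp.inv_eq (by simpa using he) (fun i hi => ?_) (fun p => hW0 _)
    ⟨0, fun i hi => ?_⟩ ?_ ?_
  · rw [adjoint, hWneg _ (by simpa using hi)]
    rfl
  · rw [adjoint, hVneg _ (by simpa using hi)]
    rfl
  · rw [← DiffOp.adjoint_mul, hVW, DiffOp.adjoint_one]
  · rw [← DiffOp.adjoint_mul, hWV, DiffOp.adjoint_one]

/-- The formula for `(W^*)⁻¹ χ⁻¹`. Here `Θ = Λ⁻¹`, and the projection `A_-` is the part of degree at
least `1` in `Θ`. -/
theorem adjWave_eq {L W Wbar : DiffOp Ω} (hsol : IsSolution L W Wbar) {τ : Fn Ω}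
    (hτ : IsTau W Wbar τ) :
    adjWave W = ⟨ZSeries.divFn (tShift 1 (Fn.shift 1 τ)) (Fn.shift 1 τ), -chi Ω⟩ := by
  have hneg : ∀ i : ℤ, -1 * i < 0 → W i = 0 := fun i hi => hsol.W_pos i (by omega)
  have h0 : ∀ p, W 0 p ≠ 0 := fun p => by simp [hsol.W_zero]
  obtain ⟨V, hVneg, hWV, hVW, hV⟩ := sato_inverse (e := -1) (by norm_num) 1 (1 : 𝕜) TodaVar.t
    hsol.W_smooth hneg h0 (Or.inr ⟨rfl, hsol.W_zero⟩)
    (fun n => by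
      rw [one_smul, hsol.flow_t, bdd_neg_one, neg_one_mul, neg_neg]
      congr 2
      funext i
      rw [neg, fracPow, projGE]
      by_cases hi : i < 0
      · rw [if_pos hi, if_pos (by omega)]
      · rw [if_neg hi, if_neg (by omega)])
    hτ.smooth hτ.smooth (fun i => by
      have h := congrFun (congrArg Osc.amp hτ.wave_eq) (-1 * i)
      rw [wave, applyExp_amp (δ := 1) (by norm_num) _ (by simpa using shift_chi (Ω := Ω)),
        one_mul] at h
      rw [h]
      funext p
      have h1 : (-1 * (i : ℤ)) ≤ 0 := by omega
      have h2 : (-(-1 * (i : ℤ))).toNat = i := by omega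
      simp only [ZSeries.divFn, tShift, Pi.mul_apply, h1, if_true, h2]
      exact div_mul_cancel₀ _ (hτ.ne_zero p))
  have hadj : inv (bddBelow Ω) (adjoint W) = adjoint V := by
    rw [← bdd_one]
    exact inv_adjoint (e := -1) (by norm_num) hneg h0 hVneg hWV hVW
  refine Osc.ext (funext fun n => ?_) rfl
  rw [adjWave, hadj, applyExp_adjoint_amp V shift_chi]
  funext p
  rcases le_or_gt n 0 with hn | hn
  · obtain ⟨j, rfl⟩ : ∃ j : ℕ, n = -1 * j := ⟨(-n).toNat, by omega⟩
    have h2 : (-(-1 * (j : ℤ))).toNat = j := by omega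
    simp only [ZSeries.divFn, tShift, hn, if_true, h2, shiftCoeff_shift]
    rw [← hV j]
    refine eq_div_of_mul_eq (hτ.ne_zero _) ?_
    change _ = Fn.shift 1 (Fn.shift _ (V _)) p * _
    rw [Fn.shift_shift]
    congr 3
    push_cast
    ring
  · rw [hVneg n (by omega)]
    simp [ZSeries.divFn, tShift, not_le.2 hn, Fn.shift]

/-- The formula for `(W̄^*)⁻¹ χ̄⁻¹`. Here `Θ = Λ`, and the projection `A_+` is the part of degree at
least `0`. The sign `ε = -1` turns the equations `∂W̄/∂t̄ₙ = B_+ W̄` into Sato equations. -/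
theorem adjWaveBar_eq {L W Wbar : DiffOp Ω} (hsol : IsSolution L W Wbar) {τ : Fn Ω}
    (hτ : IsTau W Wbar τ) :
    adjWaveBar Wbar = ⟨ZSeries.divFn (tbarShift (-1) τ) (Fn.shift 1 τ), -chiBar Ω⟩ := by
  have hneg : ∀ i : ℤ, 1 * i < 0 → Wbar i = 0 := fun i hi => hsol.Wbar_neg i (by omega)
  obtain ⟨V, hVneg, hWV, hVW, hV⟩ := sato_inverse (e := 1) (by norm_num) 0 (-1 : 𝕜) TodaVar.tbar
    hsol.Wbar_smooth hneg hsol.Wbar_zero (Or.inl rfl)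
    (fun n => by
      rw [neg_one_smul, hsol.flow_tbar_bar, bdd_one, one_mul]
      congr 2
      funext i
      rw [pos, fracPowBar, projGE, one_mul]
      rfl)
    hτ.smooth (hτ.smooth.shift 1) (fun i => by
      have h := congrFun (congrArg Osc.amp hτ.waveBar_eq) (1 * i)
      rw [waveBar, applyExp_amp (δ := 1) (by norm_num) _ (by simpa using shift_chiBar (Ω := Ω)),
        one_mul] at h
      rw [h]
      funext p
      have h1 : 0 ≤ (1 * (i : ℤ)) := by omega
      have h2 : (1 * (i : ℤ)).toNat = i := by omega
      simp only [ZSeries.divFn, tbarShift, Pi.mul_apply, h1, if_true, h2, neg_neg]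
      exact div_mul_cancel₀ _ (hτ.ne_zero p))
  have hadj : inv (bddAbove Ω) (adjoint Wbar) = adjoint V := by
    rw [← bdd_neg_one]
    exact inv_adjoint (e := 1) (by norm_num) hneg hsol.Wbar_zero hVneg hWV hVW
  refine Osc.ext (funext fun n => ?_) rfl
  rw [adjWaveBar, hadj, applyExp_adjoint_amp V shift_chiBar]
  funext p
  rcases le_or_gt 0 n with hn | hn
  · lift n to ℕ using hn
    have h1 : 0 ≤ (n : ℤ) := by omega
    simp only [ZSeries.divFn, tbarShift, h1, if_true, Int.toNat_natCast]
    rw [← hV n]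
    refine eq_div_of_mul_eq (hτ.ne_zero _) ?_
    rw [one_mul, one_mul, Nat.cast_zero, zero_sub]
    rfl
  · rw [hVneg n (by omega)]
    simp [ZSeries.divFn, tbarShift, not_le.2 hn, Fn.shift]

end Waves
end EBTH

end

/-- The dual wave functions of a solution of the extended bigraded Toda hierarchy are
`ψ^* = τ(s, t+[z⁻¹], t̄, x) / τ(s, t, t̄, x) · χ⁻¹` and
`ψ̄^* = τ(s-1, t, t̄-[z], x) / τ(s, t, t̄, x) · χ̄⁻¹`; equivalently,
`(W^*)⁻¹ χ⁻¹ = τ(s+1, t+[z⁻¹], t̄, x) / τ(s+1, t, t̄, x) · χ⁻¹` and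
`(W̄^*)⁻¹ χ̄⁻¹ = τ(s, t, t̄-[z], x) / τ(s+1, t, t̄, x) · χ̄⁻¹`. -/
theorem proposition2p5 {𝕜 : Type*} [RCLike 𝕜] (k m : ℕ+) (Ω : EBTH.Domain 𝕜 k m)
    (L W Wbar : EBTH.DiffOp Ω) (hsol : EBTH.IsSolution L W Wbar)
    (τ : EBTH.Fn Ω) (hτ : EBTH.IsTau W Wbar τ) :
    (EBTH.dualWave W =
        ⟨EBTH.ZSeries.divFn (EBTH.tShift 1 τ) τ, -EBTH.chi Ω⟩ ∧
      EBTH.dualWaveBar Wbar =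
        ⟨EBTH.ZSeries.divFn (EBTH.tbarShift (-1) (EBTH.Fn.shift (-1) τ)) τ, -EBTH.chiBar Ω⟩) ∧
    (EBTH.adjWave W =
        ⟨EBTH.ZSeries.divFn (EBTH.tShift 1 (EBTH.Fn.shift 1 τ)) (EBTH.Fn.shift 1 τ),
          -EBTH.chi Ω⟩ ∧
      EBTH.adjWaveBar Wbar =
        ⟨EBTH.ZSeries.divFn (EBTH.tbarShift (-1) τ) (EBTH.Fn.shift 1 τ), -EBTH.chiBar Ω⟩) := by
  have hw := EBTH.adjWave_eq hsol hτ
  have hwb := EBTH.adjWaveBar_eq hsol hτ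
  refine ⟨⟨?_, ?_⟩, hw, hwb⟩
  · refine EBTH.Osc.ext (funext fun n => ?_) rfl
    rw [EBTH.dualWave, EBTH.applyExp_conj_lam_amp _ EBTH.shift_chi]
    change EBTH.Fn.shift (-1) ((EBTH.adjWave W).amp n) = _
    rw [hw]
    funext p
    change EBTH.Fn.shift (-1) (EBTH.tShift 1 (EBTH.Fn.shift 1 τ) n) p /
      EBTH.Fn.shift (-1) (EBTH.Fn.shift 1 τ) p = _
    rw [EBTH.tShift_shift, EBTH.Fn.shift_shift, EBTH.Fn.shift_shift, neg_add_cancel,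
      EBTH.Fn.shift_zero, EBTH.Fn.shift_zero]
    rfl
  · refine EBTH.Osc.ext (funext fun n => ?_) rfl
    rw [EBTH.dualWaveBar, EBTH.applyExp_conj_lam_amp _ EBTH.shift_chiBar]
    change EBTH.Fn.shift (-1) ((EBTH.adjWaveBar Wbar).amp n) = _
    rw [hwb]
    funext p
    change EBTH.Fn.shift (-1) (EBTH.tbarShift (-1) τ n) p /
      EBTH.Fn.shift (-1) (EBTH.Fn.shift 1 τ) p = _
    rw [← EBTH.tbarShift_shift, EBTH.Fn.shift_shift, neg_add_cancel, EBTH.Fn.shift_zero]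
    rfl
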